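/- **Setting.** There are $Q$ secondary users and $N\ge 1$ carriers. $H_{qr}(k)$ is the channel from secondary transmitter $r$ to secondary receiver $q$ (with $H_{qq}(k)\neq 0$), $\sigma_{q,k}^2>0$ is the noise power, and $G_{P,q}(k)$ is the channel from secondary transmitter $q$ to the primary receiver. Put $\hat\sigma_{q,k}^2=\sigma_{q,k}^2/|H_{qq}(k)|^2$ and $\hat H_{qr}(k)=H_{qr}(k)/H_{qq}(k)$. The sensing parameters satisfy $\mu_{q,k|0}<\mu_{q,k|1}$, $\sigma_{q,k|0},\sigma_{q,k|1}>0$, $f_q>0$, $0<\tau_q^{\min}<\tau_q^{\max}<T_q$, $0<\alpha_{q,k},\beta_q\le 1/2$; moreover $P_q>0$, $p_{q,k}^{\max}>0$, $I_q^{\max}>0$, $I^{\max}>0$, $c\ge 0$. Write $\Delta_{q,k}=\mu_{q,k|1}-\mu_{q,k|0}$ and $\mathcal Q(x)=\frac1{\sqrt{2\pi}}\int_x^\infty e^{-t^2/2}dt$. The weights are $w_{q,k}=|G_{P,q}(k)|^2$. A strategy of user $q$ is $\mathbf x_q=(\hat\tau_q,(p_{q,k})_{k},P_q^{\rm fa})\in\mathbb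 R^{N+2}$. Put $$P^{\rm miss}_{q,k}=1-\mathcal Q\Big(\tfrac{\sigma_{q,k|0}\mathcal Q^{-1}(P_q^{\rm fa})-\Delta_{q,k}\hat\tau_q}{\sigma_{q,k|1}}\Big),\qquad r_{q,k}=\log\Big(1+\tfrac{p_{q,k}}{\hat\sigma_{q,k}^2+\sum_{r\ne q}|\hat H_{qr}(k)|^2p_{r,k}}\Big),$$ $$\theta_q(\mathbf x)=\log\Big(\big(1-\tfrac{\hat\tau_q^2}{f_qT_q}\big)(1-P_q^{\rm fa})\sum_k r_{q,k}\Big)-\tfrac c2\Big(\tfrac{\hat\tau_q}{\sqrt{f_q}}-\tfrac1Q\sum_{r=1}^Q\tfrac{\hat\tau_r}{\sqrt{f_r}}\Big)^2\qquad(\log 0=-\infty),$$ $$I_q(\mathbf x_q)=\sum_kP^{\rm miss}_{q,k}w_{q,k}p_{q,k}-I_q^{\max},\qquad I(\mathbf x)=\sum_k\sum_qP^{\rm miss}_{q,k}w_{q,k}p_{q,k}-I^{\max}.$$ $\mathcal Y_q$ is the set of $\mathbf x_q$ with $0<P_q^{\rm fa}\le\beta_q$, $\frac{\sigma_{q,k|0}}{\sigma_{q,k|1}}\mathcal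 Q^{-1}(P_q^{\rm fa})-\hat\tau_q\frac{\Delta_{q,k}}{\sigma_{q,k|1}}\le\mathcal Q^{-1}(1-\alpha_{q,k})$ for all $k$, $\sum_kp_{q,k}\le P_q$, $0\le p_{q,k}\le p_{q,k}^{\max}$ for all $k$, and $\sqrt{\tau_q^{\min}f_q}\le\hat\tau_q\le\sqrt{\tau_q^{\max}f_q}$; and $\mathcal X_q=\{\mathbf x_q\in\mathcal Y_q: I_q(\mathbf x_q)\le 0\}$. The Lagrangian is $\mathcal L_q=-\theta_q+\lambda_qI_q+\pi I$. Let $$\lambda^{\max}=\sum_{q=1}^Q\frac{1/\min_{1\le r\le Q}\min\{I_r^{\max},\min_kp_{r,k}^{\max}\}}{\Big[\min_k\frac1{p_{q,k}^{\max}}\log\Big(1+\frac{p_{q,k}^{\max}}{\sigma_{q,k}^2+\sum_{r\ne q}|H_{qr}(k)|^2p_{r,k}^{\max}}\Big)\Big]\min_k\sigma_{q,k}^2}.$$ **The constant.** Index the coordinates of $\mathbf x_q$ by $\hat\tau,1,\dots,N,P$ and put $$d_{\hat\tau}=\frac{\frac2{f_qT_q}\big(1+\frac{\tau_q^{\min}}{T_q}\big)}{\big(1-\frac{\tau_q^{\min}}{T_q}\big)^2},\quad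 d_k=\frac{1/r_q^{\max}}{\big(\hat\sigma_{q,k}^2+\sum_{r=1}^Q|\hat H_{qr}(k)|^2p_{r,k}^{\max}\big)^2},\quad d_P=\frac1{(1-P_q^{{\rm fa},\min})^2},$$ with $r_q^{\max}=\sum_k\log(1+p_{q,k}^{\max}/\hat\sigma_{q,k}^2)$ and $P_q^{{\rm fa},\min}=\min_k\mathcal Q(\Delta_{q,k}\sqrt{f_q\tau_q^{\max}}/\sigma_{q,k|0})$. Let $M_q$ be the symmetric matrix whose only nonzero entries are, up to symmetry, $M_{\hat\tau k}=2\omega_{\hat\tau,k}$, $M_{Pk}=2\omega_{P,k}$, $M_{\hat\tau P}=2\sum_k\omega_{\hat\tau P,k}\,p_{q,k}^{\max}$, where, with $e_k=\exp\big\{\tfrac12\big(\tfrac{\Delta_{q,k}}{\sigma_{q,k|0}}\sqrt{f_q\tau_q^{\max}}\big)^2\big\}$, $$\omega_{\hat\tau,k}=\frac{\Delta_{q,k}}{\sqrt{2\pi}\,\sigma_{q,k|1}},\quad\omega_{P,k}=\frac{\sigma_{q,k|0}}{\sigma_{q,k|1}}e_k,\quad\omega_{\hat\tau P,k}=\max\Big\{\mathcal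 Q^{-1}(\alpha_{q,k}),\tfrac{\Delta_{q,k}}{\sigma_{q,k|1}}\sqrt{f_q\tau_q^{\max}}\Big\}e_k.$$ For $t>0$ and a reference interference level $I^{\rm tot}>0$ let $$\gamma_q^{(1)}=\frac{2\,I^{\rm tot}\max(t,\lambda^{\max})}{\min_i\big\{d_i/\sum_j[M_q]_{ij}\big\}}\qquad(i,j\in\{\hat\tau,1,\dots,N,P\}).$$ **Statement.** Fix $q$ with $\mathcal X_q\ne\emptyset$, $t>0$ and $I^{\rm tot}>0$. Then $\gamma_q^{(1)}>0$, and if $$\gamma_q^{(1)}\cdot\max_{k}\frac{|G_{P,q}(k)|^2}{I^{\rm tot}}<1,$$ then for all $\mathbf x_{-q}\in\prod_{r\ne q}\mathcal Y_r$ and all $\pi\in[0,t]$: (i) for all $\mathbf x_q\in\mathcal Y_q$ with $\mathbf p_q\ne\mathbf 0$ and all $\lambda_q\in[0,\lambda^{\max}]$, $\mathcal L_q$ is $C^2$ in $\mathbf x_q$ near that point and its Hessian $\nabla^2_{\mathbf x_q}\mathcal L_q$ there is positive definite; (ii) the problem of maximizing $\theta_q(\mathbf x_q,\mathbf x_{-q})-\pi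 I(\mathbf x_q,\mathbf x_{-q})$ over $\mathbf x_q\in\mathcal X_q$ has exactly one optimal solution, and its power component is nonzero. -/

import Mathlib

noncomputable section

namespace CognitiveRadio

open MeasureTheory

/-- The Gaussian tail function `𝒬(x) = (1/√(2π)) ∫_x^∞ e^{-t²/2} dt`. -/
def gaussQ (x : ℝ) : ℝ :=
  (1 / Real.sqrt (2 * Real.pi)) * ∫ t in Set.Ioi x, Real.exp (-t ^ 2 / 2)

/-- The inverse of the Gaussian tail function; meaningful on `(0,1)`. -/
def gaussQinv : ℝ → ℝ := Function.invFun gaussQ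

/-- Coordinates of one user's strategy tuple `(τ̂, (p_k)_{k=1}^N, P^fa) ∈ ℝ^{N+2}`. -/
abbrev Coord (N : ℕ) : Type := Unit ⊕ (Fin N ⊕ Unit)

/-- Strategy tuples of one user, as vectors of `ℝ^{N+2}`. -/
abbrev Strategy (N : ℕ) : Type := Coord N → ℝ

/-- Normalized sensing time `τ̂`. -/
def tauHat {N : ℕ} (z : Strategy N) : ℝ := z (Sum.inl ())

/-- Power `p_k` on carrier `k`. -/
def power {N : ℕ} (z : Strategy N) (k : Fin N) : ℝ := z (Sum.inr (Sum.inl k))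

/-- False alarm rate `P^fa`. -/
def pfa {N : ℕ} (z : Strategy N) : ℝ := z (Sum.inr (Sum.inr ()))

/-- The Hessian matrix of `F` at `x` (entries: second partial derivatives). -/
def hessian {ι : Type*} [Fintype ι] [DecidableEq ι] (F : (ι → ℝ) → ℝ) (x : ι → ℝ) :
    Matrix ι ι ℝ :=
  Matrix.of fun i j => fderiv ℝ (fderiv ℝ F) x (Pi.single i 1) (Pi.single j 1)

/-- `F` is twice continuously differentiable at `x` with a positive definite Hessian matrix. -/
def HasPosDefHessianAt {ι : Type*} [Fintype ι] [DecidableEq ι] (F : (ι → ℝ) → ℝ) (x : ι → ℝ) :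
    Prop :=
  ContDiffAt ℝ 2 F x ∧ (hessian F x).PosDef

/-- Parameters of a network of `Q` secondary users over `N` carriers, with the standing
assumptions on them. -/
structure System (Q N : ℕ) where
  /-- `H q r k`: channel from secondary transmitter `r` to secondary receiver `q`. -/
  H : Fin Q → Fin Q → Fin N → ℂ
  /-- Noise power spectral density `σ²_{q,k}`. -/
  noise : Fin Q → Fin N → ℝ
  /-- `G q k`: cross-channel from secondary transmitter `q` to the primary receiver. -/
  G : Fin Q → Fin N → ℂ
  /-- Mean `μ_{q,k|0}` of the energy detector without primary signal. -/
  mu0 : Fin Q → Fin N → ℝ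
  /-- Mean `μ_{q,k|1}` of the energy detector with primary signal. -/
  mu1 : Fin Q → Fin N → ℝ
  /-- Standard deviation `σ_{q,k|0}` without primary signal. -/
  s0 : Fin Q → Fin N → ℝ
  /-- Standard deviation `σ_{q,k|1}` with primary signal. -/
  s1 : Fin Q → Fin N → ℝ
  /-- Sampling frequency `f_q`. -/
  f : Fin Q → ℝ
  /-- Frame duration `T_q`. -/
  T : Fin Q → ℝ
  /-- Lower bound on the sensing time. -/
  tauMin : Fin Q → ℝ
  /-- Upper bound on the sensing time. -/
  tauMax : Fin Q → ℝ
  /-- Power budget `P_q`. -/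
  budget : Fin Q → ℝ
  /-- Spectral mask `p^max_{q,k}`. -/
  pMax : Fin Q → Fin N → ℝ
  /-- Upper bound `α_{q,k}` on the missed detection probability. -/
  alpha : Fin Q → Fin N → ℝ
  /-- Upper bound `β_q` on the false alarm rate. -/
  beta : Fin Q → ℝ
  /-- Local interference limit `I_q^max`. -/
  ILoc : Fin Q → ℝ
  /-- Global interference limit `I^max`. -/
  IGlob : ℝ
  /-- Equi-sensing penalty weight `c`. -/
  c : ℝ
  H_ne : ∀ q k, H q q k ≠ 0
  noise_pos : ∀ q k, 0 < noise q k
  mu_lt : ∀ q k, mu0 q k < mu1 q k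
  s0_pos : ∀ q k, 0 < s0 q k
  s1_pos : ∀ q k, 0 < s1 q k
  f_pos : ∀ q, 0 < f q
  tauMin_pos : ∀ q, 0 < tauMin q
  tauMin_lt : ∀ q, tauMin q < tauMax q
  tauMax_lt : ∀ q, tauMax q < T q
  budget_pos : ∀ q, 0 < budget q
  pMax_pos : ∀ q k, 0 < pMax q k
  alpha_pos : ∀ q k, 0 < alpha q k
  alpha_le : ∀ q k, alpha q k ≤ 1 / 2
  beta_pos : ∀ q, 0 < beta q
  beta_le : ∀ q, beta q ≤ 1 / 2
  ILoc_pos : ∀ q, 0 < ILoc q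
  IGlob_pos : 0 < IGlob
  c_nonneg : 0 ≤ c

namespace System

variable {Q N : ℕ} (S : System Q N)

/-- Interference weights `w_{q,k} = |G_{P,q}(k)|²`. -/
def w (q : Fin Q) (k : Fin N) : ℝ := ‖S.G q k‖ ^ 2

/-- Normalized noise `σ̂²_{q,k} = σ²_{q,k} / |H_qq(k)|²`. -/
def noiseHat (q : Fin Q) (k : Fin N) : ℝ := S.noise q k / ‖S.H q q k‖ ^ 2

/-- Normalized channel gain `|Ĥ_qr(k)|² = |H_qr(k) / H_qq(k)|²`. -/
def gainHat (q r : Fin Q) (k : Fin N) : ℝ := ‖S.H q r k / S.H q q k‖ ^ 2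

/-- Missed detection probability `P^miss = 1 - 𝒬((σ₀ 𝒬⁻¹(P^fa) - (μ₁ - μ₀) τ̂) / σ₁)`. -/
def pMiss (q : Fin Q) (k : Fin N) (P tau : ℝ) : ℝ :=
  1 - gaussQ ((S.s0 q k * gaussQinv P - (S.mu1 q k - S.mu0 q k) * tau) / S.s1 q k)

/-- Rate `r_{q,k}` of user `q` on carrier `k`. -/
def rate (q : Fin Q) (k : Fin N) (x : Fin Q → Strategy N) : ℝ :=
  Real.log (1 + power (x q) k /
    (S.noiseHat q k + ∑ r ∈ Finset.univ.erase q, S.gainHat q r k * power (x r) k))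

/-- Opportunistic throughput of user `q`:
`(1 - τ̂_q² / (f_q T_q)) (1 - P_q^fa) ∑_k r_{q,k}`. -/
def throughput (q : Fin Q) (x : Fin Q → Strategy N) : ℝ :=
  (1 - tauHat (x q) ^ 2 / (S.f q * S.T q)) * (1 - pfa (x q)) * ∑ k, S.rate q k x

/-- Payoff `θ_q`: log-throughput minus the equi-sensing penalty (where the throughput is
positive). -/
def theta (q : Fin Q) (x : Fin Q → Strategy N) : ℝ :=
  Real.log (S.throughput q x) -
    S.c / 2 * (tauHat (x q) / Real.sqrt (S.f q) -
      1 / (Q : ℝ) * ∑ r, tauHat (x r) / Real.sqrt (S.f r)) ^ 2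

/-- Local interference violation `I_q(x_q)`. -/
def locViol (q : Fin Q) (z : Strategy N) : ℝ :=
  ∑ k, S.pMiss q k (pfa z) (tauHat z) * S.w q k * power z k - S.ILoc q

/-- Global interference violation `I(x)`. -/
def globViol (x : Fin Q → Strategy N) : ℝ :=
  ∑ k, ∑ q, S.pMiss q k (pfa (x q)) (tauHat (x q)) * S.w q k * power (x q) k - S.IGlob

/-- The convex part `𝒴_q` of the strategy set of user `q`. -/
def Y (q : Fin Q) : Set (Strategy N) :=
  {z | 0 < pfa z ∧ pfa z ≤ S.beta q ∧
    (∀ k, S.s0 q k / S.s1 q k * gaussQinv (pfa z) -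
        tauHat z * ((S.mu1 q k - S.mu0 q k) / S.s1 q k) ≤ gaussQinv (1 - S.alpha q k)) ∧
    ∑ k, power z k ≤ S.budget q ∧
    (∀ k, 0 ≤ power z k ∧ power z k ≤ S.pMax q k) ∧
    Real.sqrt (S.tauMin q * S.f q) ≤ tauHat z ∧ tauHat z ≤ Real.sqrt (S.tauMax q * S.f q)}

/-- The strategy set `𝒳_q` of user `q`. -/
def X (q : Fin Q) : Set (Strategy N) := {z | z ∈ S.Y q ∧ S.locViol q z ≤ 0}

/-- User `q`'s objective `θ_q(z, x_{-q}) - π I(z, x_{-q})` with its natural value `-∞` where the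
throughput vanishes (`log 0 = -∞`). -/
def objective (q : Fin Q) (x : Fin Q → Strategy N) (price : ℝ) (z : Strategy N) : EReal :=
  if 0 < S.throughput q (Function.update x q z) then
    ((S.theta q (Function.update x q z) - price * S.globViol (Function.update x q z) : ℝ) : EReal)
  else ⊥

/-- `z` is an optimal solution of user `q`'s problem: maximize `θ_q - π I` over `𝒳_q`. -/
def IsBestResponse (q : Fin Q) (x : Fin Q → Strategy N) (price : ℝ) (z : Strategy N) : Prop :=
  z ∈ S.X q ∧ IsMaxOn (S.objective q x price) (S.X q) z

/-- Lagrangian `-θ_q + λ I_q + π I` of user `q`, as a function of the own strategy `z`. -/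
def lagrangian (q : Fin Q) (x : Fin Q → Strategy N) (price lam : ℝ) (z : Strategy N) : ℝ :=
  -S.theta q (Function.update x q z) + lam * S.locViol q z +
    price * S.globViol (Function.update x q z)

/-- The bound `λ^max` on the multipliers. -/
def lamMax : ℝ :=
  ∑ q : Fin Q,
    (1 / ⨅ r : Fin Q, min (S.ILoc r) (⨅ k : Fin N, S.pMax r k)) /
      ((⨅ k : Fin N, 1 / S.pMax q k * Real.log (1 + S.pMax q k /
          (S.noise q k + ∑ r ∈ Finset.univ.erase q, ‖S.H q r k‖ ^ 2 * S.pMax r k))) *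
        ⨅ k : Fin N, S.noise q k)

/-- `r_q^max = ∑_k log(1 + p^max_{q,k} / σ̂²_{q,k})`. -/
def rMax (q : Fin Q) : ℝ := ∑ k, Real.log (1 + S.pMax q k / S.noiseHat q k)

/-- Largest normalized sensing time `√(f_q τ_q^max)`. -/
def tauHatMax (q : Fin Q) : ℝ := Real.sqrt (S.f q * S.tauMax q)

/-- Smallest false alarm rate `min_k 𝒬((μ₁ - μ₀) √(f_q τ_q^max) / σ₀)`. -/
def pfaMin (q : Fin Q) : ℝ :=
  ⨅ k : Fin N, gaussQ ((S.mu1 q k - S.mu0 q k) * S.tauHatMax q / S.s0 q k)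

/-- Lower bounds on the curvature of `-θ_q` in the coordinates `τ̂_q`, `p_{q,k}`, `P_q^fa`. -/
def dMin (q : Fin Q) : Coord N → ℝ
  | Sum.inl _ =>
      2 / (S.f q * S.T q) * (1 + S.tauMin q / S.T q) / (1 - S.tauMin q / S.T q) ^ 2
  | Sum.inr (Sum.inl k) =>
      (1 / S.rMax q) / (S.noiseHat q k + ∑ r, S.gainHat q r k * S.pMax r k) ^ 2
  | Sum.inr (Sum.inr _) => 1 / (1 - S.pfaMin q) ^ 2

/-- `ω^max_{τ̂_q,k}`. -/
def omTau (q : Fin Q) (k : Fin N) : ℝ :=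
  1 / Real.sqrt (2 * Real.pi) * ((S.mu1 q k - S.mu0 q k) / S.s1 q k)

/-- `ω^max_{P_q^fa,k}`. -/
def omPfa (q : Fin Q) (k : Fin N) : ℝ :=
  S.s0 q k / S.s1 q k *
    Real.exp (((S.mu1 q k - S.mu0 q k) / S.s0 q k * S.tauHatMax q) ^ 2 / 2)

/-- `ω^max_{τ̂_q P_q^fa,k}`. -/
def omTauPfa (q : Fin Q) (k : Fin N) : ℝ :=
  max (gaussQinv (S.alpha q k)) ((S.mu1 q k - S.mu0 q k) / S.s1 q k * S.tauHatMax q) *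
    Real.exp (((S.mu1 q k - S.mu0 q k) / S.s0 q k * S.tauHatMax q) ^ 2 / 2)

/-- The matrix `[∇² I_q]_off^up`, symmetric with zero diagonal. -/
def offUp (q : Fin Q) : Matrix (Coord N) (Coord N) ℝ
  | Sum.inl _, Sum.inr (Sum.inl k) => 2 * S.omTau q k
  | Sum.inr (Sum.inl k), Sum.inl _ => 2 * S.omTau q k
  | Sum.inr (Sum.inr _), Sum.inr (Sum.inl k) => 2 * S.omPfa q k
  | Sum.inr (Sum.inl k), Sum.inr (Sum.inr _) => 2 * S.omPfa q k
  | Sum.inl _, Sum.inr (Sum.inr _) => 2 * ∑ k, S.omTauPfa q k * S.pMax q k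
  | Sum.inr (Sum.inr _), Sum.inl _ => 2 * ∑ k, S.omTauPfa q k * S.pMax q k
  | _, _ => 0

/-- The constant `γ_q^(1)`, for the price bound `t` and the interference level `Itot` to which
the cross-channels are normalized. -/
def gamma1 (q : Fin Q) (t Itot : ℝ) : ℝ :=
  Itot * (2 * max t S.lamMax) / ⨅ i : Coord N, S.dMin q i / ∑ j, S.offUp q i j

end System

end CognitiveRadio

end

/-! Split `-log` of the throughput into a term in `τ̂`, a term in `P^fa` and a term in the powers.
Along any line through a point of `𝒴_q` with nonzero power, the second derivatives of these three
terms are at least the quadratic forms with coefficients `d_τ̂`, `d_P`, `d_k` (`neg_log_tau_line`,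
`neg_log_pfa_line`, `neg_log_sumRate_line`), and the penalty is convex. The only nonconvexity comes
from the interference `∑ P^miss w p`. On `𝒴_q` the missed detection probability is itself convex in
`(τ̂, P^fa)`, because the argument of `𝒬` is nonpositive there. So only the cross terms between a
power and `τ̂` or `P^fa` can be negative (`leak_line`). The bound on `γ` makes the diagonal
curvature dominate these cross terms (`curvature_pos`), which gives (i).

For (ii), `𝒳_q` need not be convex, so only the local interference constraint is dualized. For each
`λ` in `[0, 1/I_q^max]`, an interval inside `[0, λ^max]`, part (i) makes the Lagrangian strictly
convex on the convex set of points of `𝒴_q` with nonzero power. It has a minimizer there because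
`exp(-L)` extends continuously by zero to the zero-power points and `𝒴_q` is compact. Shrinking the
powers of a minimizer shows that `(λ + π)` times its interference is at most `1`
(`mul_leak_le_one`), so the constraint holds at `λ = 1/I_q^max`. If it fails at `λ = 0`,
connectedness of the interval and uniqueness of minimizers yield a `λ` whose minimizer meets the
constraint with equality (`exists_complementary`). Complementary slackness then certifies global
optimality over `𝒳_q`, and strict convexity of the Lagrangian for that single `λ` gives uniqueness.
-/

noncomputable section

namespace CognitiveRadio

open MeasureTheory Filter Topology

/-! ### The Gaussian tail function and its inverse. -/

/-- The standard Gaussian density. -/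
def gaussPhi (x : ℝ) : ℝ := (1 / Real.sqrt (2 * Real.pi)) * Real.exp (-x ^ 2 / 2)

lemma gaussPhi_pos (x : ℝ) : 0 < gaussPhi x := by
  unfold gaussPhi; positivity

lemma integrable_exp_neg_sq_half : Integrable (fun t : ℝ => Real.exp (-t ^ 2 / 2)) := by
  have h := integrable_exp_neg_mul_sq (b := 1 / 2) (by norm_num)
  refine h.congr (Filter.Eventually.of_forall fun x => ?_)
  simp only
  congr 1; ring

lemma gaussQ_eq (x : ℝ) : gaussQ x = gaussQ 0 -
    (1 / Real.sqrt (2 * Real.pi)) * ∫ t in (0 : ℝ)..x, Real.exp (-t ^ 2 / 2) := by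
  have h := intervalIntegral.integral_Ioi_sub_Ioi' (μ := volume)
    (f := fun t : ℝ => Real.exp (-t ^ 2 / 2)) (a := 0) (b := x)
    integrable_exp_neg_sq_half.integrableOn integrable_exp_neg_sq_half.integrableOn
  rw [← h]; unfold gaussQ; ring

lemma gaussQ_zero : gaussQ 0 = 1 / 2 := by
  have h := integral_gaussian_Ioi (1 / 2)
  have h2 : (∫ x in Set.Ioi (0 : ℝ), Real.exp (-x ^ 2 / 2)) =
      ∫ x in Set.Ioi (0 : ℝ), Real.exp (-(1 / 2) * x ^ 2) := by
    congr 1; ext x; congr 1; ring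
  have h3 : Real.pi / (1 / 2) = 2 * Real.pi := by ring
  have : 0 < Real.sqrt (2 * Real.pi) := by positivity
  unfold gaussQ
  rw [h2, h, h3]; field_simp

lemma hasDerivAt_gaussQ (x : ℝ) : HasDerivAt gaussQ (-gaussPhi x) x := by
  have hc : Continuous fun t : ℝ => Real.exp (-t ^ 2 / 2) := by fun_prop
  have h := intervalIntegral.integral_hasDerivAt_right (a := 0) (b := x)
    (hc.intervalIntegrable _ _) hc.aestronglyMeasurable.stronglyMeasurableAtFilter
    hc.continuousAt
  have h2 := (h.const_mul (1 / Real.sqrt (2 * Real.pi))).const_sub (gaussQ 0)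
  exact h2.congr_of_eventuallyEq (Filter.Eventually.of_forall gaussQ_eq)

lemma continuous_gaussQ : Continuous gaussQ :=
  continuous_iff_continuousAt.2 fun x => (hasDerivAt_gaussQ x).continuousAt

lemma strictAnti_gaussQ : StrictAnti gaussQ :=
  strictAnti_of_hasDerivAt_neg hasDerivAt_gaussQ fun x => neg_neg_of_pos (gaussPhi_pos x)

lemma contDiff_gaussPhi {n : WithTop ℕ∞} : ContDiff ℝ n gaussPhi := by
  unfold gaussPhi; fun_prop

lemma deriv_gaussQ : deriv gaussQ = fun x => -gaussPhi x :=
  funext fun x => (hasDerivAt_gaussQ x).deriv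

lemma contDiff_gaussQ : ContDiff ℝ 2 gaussQ := by
  rw [show (2 : WithTop ℕ∞) = 1 + 1 by norm_num, contDiff_succ_iff_deriv]
  refine ⟨fun x => (hasDerivAt_gaussQ x).differentiableAt, by simp, ?_⟩
  rw [deriv_gaussQ]; exact contDiff_gaussPhi.neg

lemma gaussQ_neg (x : ℝ) : gaussQ (-x) = 1 - gaussQ x := by
  have h : (∫ t in (0 : ℝ)..(-x), Real.exp (-t ^ 2 / 2)) =
      -∫ t in (0 : ℝ)..x, Real.exp (-t ^ 2 / 2) := by
    have := intervalIntegral.integral_comp_neg (a := 0) (b := x)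
      (fun t : ℝ => Real.exp (-t ^ 2 / 2))
    simp only [neg_sq, neg_zero] at this
    rw [this, intervalIntegral.integral_symm]
  rw [gaussQ_eq (-x), gaussQ_eq x, h, gaussQ_zero]; ring

lemma tendsto_gaussQ_atTop : Tendsto gaussQ atTop (𝓝 0) := by
  have h := intervalIntegral_tendsto_integral_Ioi (0 : ℝ)
    (integrable_exp_neg_sq_half.integrableOn) tendsto_id
  have h2 := (h.const_mul (1 / Real.sqrt (2 * Real.pi))).const_sub (gaussQ 0)
  have e : gaussQ 0 - (1 / Real.sqrt (2 * Real.pi)) *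
      (∫ t in Set.Ioi (0 : ℝ), Real.exp (-t ^ 2 / 2)) = 0 := by unfold gaussQ; ring
  rw [e] at h2
  exact h2.congr fun x => (gaussQ_eq x).symm

lemma gaussQ_pos (x : ℝ) : 0 < gaussQ x := by
  have h : 0 ≤ gaussQ (x + 1) :=
    strictAnti_gaussQ.antitone.le_of_tendsto tendsto_gaussQ_atTop _
  exact h.trans_lt (strictAnti_gaussQ (by linarith))

lemma gaussQ_lt_one (x : ℝ) : gaussQ x < 1 := by
  have := gaussQ_neg x
  have := gaussQ_pos (-x)
  linarith

lemma exists_gaussQ_eq {y : ℝ} (h0 : 0 < y) (h1 : y < 1) : ∃ x, gaussQ x = y := by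
  have key : ∀ {y : ℝ}, 0 < y → ∃ x, gaussQ x < y := fun h =>
    (tendsto_gaussQ_atTop.eventually (gt_mem_nhds h)).exists
  obtain ⟨a, ha⟩ := key h0
  obtain ⟨b, hb⟩ := key (sub_pos.2 h1)
  have hb' : y < gaussQ (-b) := by rw [gaussQ_neg]; linarith
  exact mem_range_of_exists_le_of_exists_ge continuous_gaussQ ⟨a, ha.le⟩ ⟨-b, hb'.le⟩

lemma gaussQinv_gaussQ (x : ℝ) : gaussQinv (gaussQ x) = x :=
  Function.leftInverse_invFun strictAnti_gaussQ.injective x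

lemma gaussQ_gaussQinv {y : ℝ} (h0 : 0 < y) (h1 : y < 1) : gaussQ (gaussQinv y) = y :=
  Function.invFun_eq (exists_gaussQ_eq h0 h1)

lemma gaussQinv_le_iff {y : ℝ} (h0 : 0 < y) (h1 : y < 1) (x : ℝ) :
    gaussQinv y ≤ x ↔ gaussQ x ≤ y := by
  conv_rhs => rw [← gaussQ_gaussQinv h0 h1]
  exact strictAnti_gaussQ.le_iff_ge.symm

lemma le_gaussQinv_iff {y : ℝ} (h0 : 0 < y) (h1 : y < 1) (x : ℝ) :
    x ≤ gaussQinv y ↔ y ≤ gaussQ x := by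
  conv_rhs => rw [← gaussQ_gaussQinv h0 h1]
  exact strictAnti_gaussQ.le_iff_ge.symm

lemma gaussQinv_nonneg {y : ℝ} (h0 : 0 < y) (h1 : y ≤ 1 / 2) : 0 ≤ gaussQinv y := by
  rw [le_gaussQinv_iff h0 (by linarith), gaussQ_zero]; exact h1

lemma gaussQinv_nonpos {y : ℝ} (h0 : 1 / 2 ≤ y) (h1 : y < 1) : gaussQinv y ≤ 0 := by
  rw [gaussQinv_le_iff (by linarith) h1, gaussQ_zero]; exact h0

lemma hasDerivAt_gaussQinv {y : ℝ} (h0 : 0 < y) (h1 : y < 1) :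
    HasDerivAt gaussQinv (-gaussPhi (gaussQinv y))⁻¹ y := by
  have hs : HasStrictDerivAt gaussQ (-gaussPhi (gaussQinv y)) (gaussQinv y) :=
    contDiff_gaussQ.contDiffAt.hasStrictDerivAt' (hasDerivAt_gaussQ _) (by norm_num)
  have := hs.to_local_left_inverse (neg_ne_zero.2 (gaussPhi_pos _).ne')
    (Filter.Eventually.of_forall gaussQinv_gaussQ)
  rw [gaussQ_gaussQinv h0 h1] at this
  exact this.hasDerivAt

/-- Bootstrapping: the derivative is a smooth expression in the function itself, so each order of
smoothness yields the next. -/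
lemma contDiffOn_gaussQinv : ContDiffOn ℝ 2 gaussQinv (Set.Ioo 0 1) := by
  have hd : Set.EqOn (deriv gaussQinv) (fun y => (-gaussPhi (gaussQinv y))⁻¹) (Set.Ioo 0 1) :=
    fun y hy => (hasDerivAt_gaussQinv hy.1 hy.2).deriv
  have step : ∀ n : ℕ, ContDiffOn ℝ n gaussQinv (Set.Ioo 0 1) →
      ContDiffOn ℝ (n + 1) gaussQinv (Set.Ioo 0 1) := by
    intro n h
    rw [contDiffOn_succ_iff_deriv_of_isOpen isOpen_Ioo]
    refine ⟨fun y hy => (hasDerivAt_gaussQinv hy.1 hy.2).differentiableAt.differentiableWithinAt,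
      by simp, ContDiffOn.congr ?_ hd⟩
    exact ((contDiff_gaussPhi.comp_contDiffOn h).neg).inv
      fun y _ => neg_ne_zero.2 (gaussPhi_pos _).ne'
  have h0 : ContDiffOn ℝ (0 : ℕ) gaussQinv (Set.Ioo 0 1) := contDiffOn_zero.2
    fun y hy => (hasDerivAt_gaussQinv hy.1 hy.2).continuousAt.continuousWithinAt
  have h2 := step 1 (by simpa using step 0 h0)
  rwa [show ((1 : ℕ) : WithTop ℕ∞) + 1 = 2 by norm_num] at h2

lemma contDiffAt_gaussQinv {y : ℝ} (h0 : 0 < y) (h1 : y < 1) : ContDiffAt ℝ 2 gaussQinv y :=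
  contDiffOn_gaussQinv.contDiffAt (Ioo_mem_nhds h0 h1)

lemma hasDerivAt_gaussPhi (x : ℝ) : HasDerivAt gaussPhi (-x * gaussPhi x) x := by
  have h : HasDerivAt (fun x : ℝ => -x ^ 2 / 2) (-x) x := by
    refine (((hasDerivAt_pow 2 x).neg).div_const 2).congr_deriv ?_
    push_cast; ring
  have := (h.exp).const_mul (1 / Real.sqrt (2 * Real.pi))
  refine this.congr_deriv ?_
  unfold gaussPhi; ring

lemma gaussPhi_le (x : ℝ) : gaussPhi x ≤ 1 / Real.sqrt (2 * Real.pi) := by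
  unfold gaussPhi
  have : Real.exp (-x ^ 2 / 2) ≤ 1 := Real.exp_le_one_iff.2 (by nlinarith [sq_nonneg x])
  exact mul_le_of_le_one_right (by positivity) this

/-- Source of the exponential factor in `omPfa`: the numerator is at most its value at `0`, and the
denominator is that value times `exp(-v²/2)`. -/
lemma gaussPhi_div_le (u v : ℝ) : gaussPhi u / gaussPhi v ≤ Real.exp (v ^ 2 / 2) := by
  have h : gaussPhi v * Real.exp (v ^ 2 / 2) = 1 / Real.sqrt (2 * Real.pi) := by
    unfold gaussPhi
    rw [mul_assoc, ← Real.exp_add]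
    rw [show -v ^ 2 / 2 + v ^ 2 / 2 = 0 by ring, Real.exp_zero, mul_one]
  rw [div_le_iff₀ (gaussPhi_pos v), mul_comm, h]
  exact gaussPhi_le u

lemma convexOn_gaussQ : ConvexOn ℝ (Set.Ici 0) gaussQ := by
  refine MonotoneOn.convexOn_of_deriv (convex_Ici 0) continuous_gaussQ.continuousOn
    (fun x _ => (hasDerivAt_gaussQ x).differentiableAt.differentiableWithinAt) ?_
  rw [interior_Ici, deriv_gaussQ]
  intro x hx y hy hxy
  have hx0 : 0 < x := hx
  simp only [gaussPhi, neg_le_neg_iff]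
  gcongr

/-! ### Calculus of second derivatives in one variable. -/

/-- `f` is differentiable near `x`, with first derivative `f₁` and second derivative `f₂` at
`x`. -/
def HasSecondDerivAt (f : ℝ → ℝ) (f₁ f₂ x : ℝ) : Prop :=
  ∃ g : ℝ → ℝ, (∀ᶠ s in 𝓝 x, HasDerivAt f (g s) s) ∧ g x = f₁ ∧ HasDerivAt g f₂ x

namespace HasSecondDerivAt

variable {f g : ℝ → ℝ} {f₁ f₂ g₁ g₂ x : ℝ}

lemma deriv_deriv (h : HasSecondDerivAt f f₁ f₂ x) : deriv (deriv f) x = f₂ := by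
  obtain ⟨f', hf, -, hf'⟩ := h
  have : deriv f =ᶠ[𝓝 x] f' := hf.mono fun s hs => hs.deriv
  rw [this.deriv_eq, hf'.deriv]

lemma hasDerivAt (h : HasSecondDerivAt f f₁ f₂ x) : HasDerivAt f f₁ x := by
  obtain ⟨f', hf, rfl, -⟩ := h
  exact hf.self_of_nhds

lemma congr (h : HasSecondDerivAt f f₁ f₂ x) (hg : g₁ = f₁) (hg' : g₂ = f₂) :
    HasSecondDerivAt f g₁ g₂ x := by
  rw [hg, hg']; exact h

protected lemma const (c x : ℝ) : HasSecondDerivAt (fun _ => c) 0 0 x :=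
  ⟨fun _ => 0, Eventually.of_forall fun s => hasDerivAt_const s c, rfl, hasDerivAt_const x 0⟩

protected lemma affine (a b x : ℝ) : HasSecondDerivAt (fun s => a + s * b) b 0 x :=
  ⟨fun _ => b, Eventually.of_forall fun s => by
    simpa using ((hasDerivAt_id s).mul_const b).const_add a, rfl, hasDerivAt_const x b⟩

lemma add (hf : HasSecondDerivAt f f₁ f₂ x) (hg : HasSecondDerivAt g g₁ g₂ x) :
    HasSecondDerivAt (fun s => f s + g s) (f₁ + g₁) (f₂ + g₂) x := by
  obtain ⟨f', hf, rfl, hf'⟩ := hf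
  obtain ⟨g', hg, rfl, hg'⟩ := hg
  exact ⟨fun s => f' s + g' s, by filter_upwards [hf, hg] with s a b using a.add b, rfl,
    hf'.add hg'⟩

lemma const_mul (c : ℝ) (hf : HasSecondDerivAt f f₁ f₂ x) :
    HasSecondDerivAt (fun s => c * f s) (c * f₁) (c * f₂) x := by
  obtain ⟨f', hf, rfl, hf'⟩ := hf
  exact ⟨fun s => c * f' s, by filter_upwards [hf] with s a using a.const_mul c, rfl,
    hf'.const_mul c⟩

lemma neg (hf : HasSecondDerivAt f f₁ f₂ x) :
    HasSecondDerivAt (fun s => -f s) (-f₁) (-f₂) x := by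
  obtain ⟨f', hf, rfl, hf'⟩ := hf
  exact ⟨fun s => -f' s, by filter_upwards [hf] with s a using a.fun_neg, rfl, hf'.fun_neg⟩

lemma const_sub (c : ℝ) (hf : HasSecondDerivAt f f₁ f₂ x) :
    HasSecondDerivAt (fun s => c - f s) (-f₁) (-f₂) x := by
  obtain ⟨f', hf, rfl, hf'⟩ := hf
  exact ⟨fun s => -f' s, by filter_upwards [hf] with s a using a.const_sub c, rfl, hf'.fun_neg⟩

lemma mul (hf : HasSecondDerivAt f f₁ f₂ x) (hg : HasSecondDerivAt g g₁ g₂ x) :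
    HasSecondDerivAt (fun s => f s * g s) (f₁ * g x + f x * g₁)
      (f₂ * g x + 2 * (f₁ * g₁) + f x * g₂) x := by
  have hfx := hf.hasDerivAt
  have hgx := hg.hasDerivAt
  obtain ⟨f', hf, rfl, hf'⟩ := hf
  obtain ⟨g', hg, rfl, hg'⟩ := hg
  refine ⟨fun s => f' s * g s + f s * g' s,
    by filter_upwards [hf, hg] with s a b using a.mul b, rfl, ?_⟩
  refine ((hf'.mul hgx).add (hfx.mul hg')).congr_deriv ?_
  ring

lemma sum {ι : Type*} (t : Finset ι) {F : ι → ℝ → ℝ} {F₁ F₂ : ι → ℝ}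
    (h : ∀ i ∈ t, HasSecondDerivAt (F i) (F₁ i) (F₂ i) x) :
    HasSecondDerivAt (fun s => ∑ i ∈ t, F i s) (∑ i ∈ t, F₁ i) (∑ i ∈ t, F₂ i) x := by
  classical
  induction t using Finset.induction_on with
  | empty => simpa using HasSecondDerivAt.const 0 x
  | insert a t ha ih =>
    simp only [Finset.sum_insert ha]
    exact (h a (by simp)).add (ih fun i hi => h i (by simp [hi]))

lemma comp (hg : HasSecondDerivAt g g₁ g₂ (f x)) (hf : HasSecondDerivAt f f₁ f₂ x) :
    HasSecondDerivAt (fun s => g (f s)) (g₁ * f₁) (g₂ * f₁ ^ 2 + g₁ * f₂) x := by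
  have hfx := hf.hasDerivAt
  obtain ⟨f', hf, rfl, hf'⟩ := hf
  obtain ⟨g', hg, rfl, hg'⟩ := hg
  refine ⟨fun s => g' (f s) * f' s, ?_, rfl, ?_⟩
  · filter_upwards [hf, hfx.continuousAt.eventually hg] with s a b using b.comp s a
  · refine ((hg'.comp x hfx).mul hf').congr_deriv ?_
    simp only [Function.comp]; ring

protected lemma log (hf : HasSecondDerivAt f f₁ f₂ x) (h0 : 0 < f x) :
    HasSecondDerivAt (fun s => Real.log (f s)) (f₁ / f x) (f₂ / f x - (f₁ / f x) ^ 2) x := by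
  have h : HasSecondDerivAt Real.log (f x)⁻¹ (-((f x) ^ 2)⁻¹) (f x) :=
    ⟨fun y => y⁻¹, by
      filter_upwards [lt_mem_nhds h0] with y hy using Real.hasDerivAt_log (ne_of_gt hy), rfl,
      hasDerivAt_inv h0.ne'⟩
  refine (h.comp hf).congr (by ring) ?_
  field_simp; ring

end HasSecondDerivAt

lemma hasSecondDerivAt_gaussQ (x : ℝ) :
    HasSecondDerivAt gaussQ (-gaussPhi x) (x * gaussPhi x) x :=
  ⟨fun y => -gaussPhi y, Eventually.of_forall hasDerivAt_gaussQ, rfl,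
    (hasDerivAt_gaussPhi x).fun_neg.congr_deriv (by ring)⟩

lemma hasSecondDerivAt_gaussQinv {y : ℝ} (h0 : 0 < y) (h1 : y < 1) :
    HasSecondDerivAt gaussQinv (-(gaussPhi (gaussQinv y))⁻¹)
      (gaussQinv y * (gaussPhi (gaussQinv y))⁻¹ ^ 2) y := by
  have hp := gaussPhi_pos (gaussQinv y)
  refine ⟨fun y => (-gaussPhi (gaussQinv y))⁻¹, ?_, inv_neg, ?_⟩
  · filter_upwards [Ioo_mem_nhds h0 h1] with z hz using hasDerivAt_gaussQinv hz.1 hz.2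
  · have h := ((hasDerivAt_gaussPhi (gaussQinv y)).comp y (hasDerivAt_gaussQinv h0 h1)).neg
    refine (h.inv (neg_ne_zero.2 hp.ne')).congr_deriv ?_
    simp only [Pi.neg_apply, Function.comp]
    field_simp

/-! ### Positive definite Hessians by restriction to lines. -/

section Hessian

variable {ι : Type*} [Fintype ι]

lemma hasSecondDerivAt_line {F : (ι → ℝ) → ℝ} {x v : ι → ℝ} {s : ℝ}
    (h : ContDiffAt ℝ 2 F (x + s • v)) :
    HasSecondDerivAt (fun s : ℝ => F (x + s • v)) (fderiv ℝ F (x + s • v) v)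
      (fderiv ℝ (fderiv ℝ F) (x + s • v) v v) s := by
  have hl : ∀ s : ℝ, HasDerivAt (fun s : ℝ => x + s • v) v s := fun s => by
    simpa using ((hasDerivAt_id s).smul_const v).const_add x
  refine ⟨fun s => fderiv ℝ F (x + s • v) v, ?_, rfl, ?_⟩
  · have h1 : ∀ᶠ y in 𝓝 (x + s • v), ContDiffAt ℝ 2 F y := h.eventually (by simp)
    filter_upwards [(hl s).continuousAt.eventually h1] with r hr
    exact ((hr.differentiableAt (by norm_num)).hasFDerivAt).comp_hasDerivAt r (hl r)
  · have h2 : DifferentiableAt ℝ (fderiv ℝ F) (x + s • v) :=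
      (h.fderiv_right (m := 1) (by norm_num)).differentiableAt (by norm_num)
    have h3 := (h2.hasFDerivAt).comp_hasDerivAt s (hl s)
    simpa [Function.comp_def] using h3.clm_apply (hasDerivAt_const s v)

variable [DecidableEq ι]

lemma dotProduct_hessian_mulVec (F : (ι → ℝ) → ℝ) (x v : ι → ℝ) :
    star v ⬝ᵥ ((hessian F x).mulVec v) = fderiv ℝ (fderiv ℝ F) x v v := by
  have e : v = ∑ i, v i • (Pi.single i 1 : ι → ℝ) := by
    ext j; simp [Finset.sum_apply, Pi.single_apply]
  conv_rhs => rw [e]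
  simp only [map_sum, map_smul, sum_apply, smul_apply, smul_eq_mul, dotProduct, Matrix.mulVec,
    hessian, Matrix.of_apply, Finset.mul_sum, Pi.star_apply, star_trivial]
  rw [Finset.sum_comm]
  refine Finset.sum_congr rfl fun j _ => Finset.sum_congr rfl fun i _ => ?_
  ring

/-- The Hessian form at `v` is the second derivative of `F` along the line in direction `v`. Any
one-variable computation of that derivative may be used, since it is unique; no partial derivatives
have to be computed. -/
lemma hasPosDefHessianAt_of_line {F : (ι → ℝ) → ℝ} {x : ι → ℝ} (h : ContDiffAt ℝ 2 F x)
    (hpos : ∀ v : ι → ℝ, v ≠ 0 → ∃ f₁ f₂ : ℝ,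
      HasSecondDerivAt (fun s : ℝ => F (x + s • v)) f₁ f₂ 0 ∧ 0 < f₂) :
    HasPosDefHessianAt F x := by
  refine ⟨h, Matrix.posDef_iff_dotProduct_mulVec.2 ⟨?_, fun v hv => ?_⟩⟩
  · ext i j
    simpa [hessian] using h.isSymmSndFDerivAt (by simp) (Pi.single j 1) (Pi.single i 1)
  · obtain ⟨f₁, f₂, hf, h2⟩ := hpos v hv
    have hx : x + (0 : ℝ) • v = x := by simp
    have hl := hasSecondDerivAt_line (x := x) (v := v) (s := 0) (by rwa [hx])
    rw [hx] at hl
    rw [dotProduct_hessian_mulVec, ← hl.deriv_deriv, hf.deriv_deriv]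
    exact h2

lemma strictConvexOn_of_hasPosDefHessianAt {F : (ι → ℝ) → ℝ} {C : Set (ι → ℝ)}
    (hC : Convex ℝ C) (h : ∀ x ∈ C, HasPosDefHessianAt F x) : StrictConvexOn ℝ C F := by
  refine ⟨hC, fun x hx y hy hxy a b ha hb hab => ?_⟩
  have hmem : ∀ s ∈ Set.Icc (0 : ℝ) 1, x + s • (y - x) ∈ C := fun s hs =>
    hC.add_smul_sub_mem hx hy hs
  have hsec : ∀ s ∈ Set.Icc (0 : ℝ) 1, ∃ f₁ f₂,
      HasSecondDerivAt (fun s : ℝ => F (x + s • (y - x))) f₁ f₂ s ∧ 0 < f₂ := by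
    intro s hs
    obtain ⟨hc, hp⟩ := h _ (hmem s hs)
    refine ⟨_, _, hasSecondDerivAt_line hc, ?_⟩
    rw [← dotProduct_hessian_mulVec]
    exact (Matrix.posDef_iff_dotProduct_mulVec.1 hp).2 (sub_ne_zero.2 hxy.symm)
  have hs : StrictConvexOn ℝ (Set.Icc (0 : ℝ) 1) fun s : ℝ => F (x + s • (y - x)) := by
    refine strictConvexOn_of_deriv2_pos' (convex_Icc 0 1) (fun s hs => ?_) fun s hs => ?_
    · obtain ⟨_, _, h1, -⟩ := hsec s hs
      exact h1.hasDerivAt.continuousAt.continuousWithinAt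
    · obtain ⟨_, _, h1, h2⟩ := hsec s hs
      simpa [h1.deriv_deriv] using h2
  have := hs.2 (Set.left_mem_Icc.2 zero_le_one) (Set.right_mem_Icc.2 zero_le_one)
    zero_ne_one ha hb hab
  simp only [smul_eq_mul, mul_zero, mul_one, zero_add, zero_smul, add_zero, one_smul,
    add_sub_cancel] at this
  simp only [smul_eq_mul]
  convert this using 2
  obtain rfl : a = 1 - b := by linarith
  module

end Hessian

/-! ### The Lagrangian as a function of the own strategy, and bounds on `𝒴_q`. -/

lemma contDiff_tauHat {N : ℕ} {n : WithTop ℕ∞} : ContDiff ℝ n (tauHat : Strategy N → ℝ) :=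
  contDiff_apply ℝ ℝ (Sum.inl ())

lemma contDiff_power {N : ℕ} {n : WithTop ℕ∞} (k : Fin N) :
    ContDiff ℝ n (fun z : Strategy N => power z k) :=
  contDiff_apply ℝ ℝ (Sum.inr (Sum.inl k))

lemma contDiff_pfa {N : ℕ} {n : WithTop ℕ∞} : ContDiff ℝ n (pfa : Strategy N → ℝ) :=
  contDiff_apply ℝ ℝ (Sum.inr (Sum.inr ()))

namespace System

variable {Q N : ℕ} (S : System Q N) (q : Fin Q) (x : Fin Q → Strategy N)

/-- Normalized noise plus interference from the other users. -/
def effNoise (k : Fin N) : ℝ :=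
  S.noiseHat q k + ∑ r ∈ Finset.univ.erase q, S.gainHat q r k * power (x r) k

/-- Sum rate of user `q` as a function of the own strategy. -/
def sumRate (z : Strategy N) : ℝ := ∑ k, Real.log (1 + power z k / S.effNoise q x k)

/-- Expected interference of user `q` at the primary receiver. -/
def leak (z : Strategy N) : ℝ :=
  ∑ k, S.pMiss q k (pfa z) (tauHat z) * S.w q k * power z k

/-- Expected interference of the other users at the primary receiver. -/
def othersLeak : ℝ := ∑ r ∈ Finset.univ.erase q, S.leak r (x r)

/-- The equi-sensing penalty as a function of the own strategy. -/
def penalty (z : Strategy N) : ℝ :=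
  S.c / 2 * ((1 / Real.sqrt (S.f q) - 1 / (Q : ℝ) * (1 / Real.sqrt (S.f q))) * tauHat z -
    1 / (Q : ℝ) * ∑ r ∈ Finset.univ.erase q, tauHat (x r) / Real.sqrt (S.f r)) ^ 2

lemma throughput_update (z : Strategy N) : S.throughput q (Function.update x q z) =
    (1 - tauHat z ^ 2 / (S.f q * S.T q)) * (1 - pfa z) * S.sumRate q x z := by
  unfold throughput sumRate
  simp only [Function.update_self]
  congr 1
  refine Finset.sum_congr rfl fun k _ => ?_
  unfold rate effNoise
  simp only [Function.update_self]
  have h : ∀ r ∈ Finset.univ.erase q, S.gainHat q r k * power (Function.update x q z r) k =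
      S.gainHat q r k * power (x r) k := fun r hr => by
    rw [Function.update_of_ne (Finset.ne_of_mem_erase hr)]
  rw [Finset.sum_congr rfl h]

lemma theta_update (z : Strategy N) : S.theta q (Function.update x q z) =
    Real.log (S.throughput q (Function.update x q z)) - S.penalty q x z := by
  have h : ∑ r, tauHat (Function.update x q z r) / Real.sqrt (S.f r) =
      tauHat z / Real.sqrt (S.f q) +
        ∑ r ∈ Finset.univ.erase q, tauHat (x r) / Real.sqrt (S.f r) := by
    rw [← Finset.add_sum_erase _ _ (Finset.mem_univ q), Function.update_self]
    congr 1
    refine Finset.sum_congr rfl fun r hr => ?_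
    rw [Function.update_of_ne (Finset.ne_of_mem_erase hr)]
  unfold theta penalty
  rw [h, Function.update_self]
  ring

lemma locViol_eq (z : Strategy N) : S.locViol q z = S.leak q z - S.ILoc q := rfl

lemma globViol_update (z : Strategy N) : S.globViol (Function.update x q z) =
    S.leak q z + S.othersLeak q x - S.IGlob := by
  unfold globViol othersLeak leak
  rw [Finset.sum_comm, ← Finset.add_sum_erase _ _ (Finset.mem_univ q)]
  simp only [Function.update_self]
  congr 2
  refine Finset.sum_congr rfl fun r hr => ?_
  rw [Function.update_of_ne (Finset.ne_of_mem_erase hr)]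

/-- The local and the global constraint involve the own strategy through the same function `leak`,
so multiplier and price affect the curvature only through their sum. -/
lemma lagrangian_eq (price lam : ℝ) (z : Strategy N) : S.lagrangian q x price lam z =
    -Real.log (S.throughput q (Function.update x q z)) + S.penalty q x z +
      (lam + price) * S.leak q z +
      (price * (S.othersLeak q x - S.IGlob) - lam * S.ILoc q) := by
  unfold lagrangian
  rw [theta_update, locViol_eq, globViol_update]
  ring

lemma T_pos : 0 < S.T q := (S.tauMin_pos q).trans ((S.tauMin_lt q).trans (S.tauMax_lt q))

lemma fT_pos : 0 < S.f q * S.T q := mul_pos (S.f_pos q) (S.T_pos q)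

lemma w_nonneg (k : Fin N) : 0 ≤ S.w q k := sq_nonneg _

lemma gainHat_nonneg (r : Fin Q) (k : Fin N) : 0 ≤ S.gainHat q r k := sq_nonneg _

lemma gainHat_self (k : Fin N) : S.gainHat q q k = 1 := by
  simp [gainHat, div_self (S.H_ne q k)]

lemma noiseHat_pos (k : Fin N) : 0 < S.noiseHat q k :=
  div_pos (S.noise_pos q k) (pow_pos (norm_pos_iff.2 (S.H_ne q k)) 2)

lemma delta_pos (k : Fin N) : 0 < S.mu1 q k - S.mu0 q k := sub_pos.2 (S.mu_lt q k)

lemma pMiss_nonneg (k : Fin N) (P tau : ℝ) : 0 ≤ S.pMiss q k P tau :=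
  sub_nonneg.2 (gaussQ_lt_one _).le

variable {S q x}

section Y

variable {z : Strategy N} (hz : z ∈ S.Y q)
include hz

lemma Y.pfa_pos : 0 < pfa z := hz.1

lemma Y.pfa_le_half : pfa z ≤ 1 / 2 := hz.2.1.trans (S.beta_le q)

lemma Y.pfa_lt_one : pfa z < 1 := by
  have := Y.pfa_le_half hz; linarith

lemma Y.power_nonneg (k : Fin N) : 0 ≤ power z k := (hz.2.2.2.2.1 k).1

lemma Y.power_le (k : Fin N) : power z k ≤ S.pMax q k := (hz.2.2.2.2.1 k).2

lemma Y.tauHat_pos : 0 < tauHat z :=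
  (Real.sqrt_pos.2 (mul_pos (S.tauMin_pos q) (S.f_pos q))).trans_le hz.2.2.2.2.2.1

lemma Y.tauHat_le : tauHat z ≤ S.tauHatMax q := by
  unfold tauHatMax
  rw [mul_comm]
  exact hz.2.2.2.2.2.2

lemma Y.tauMin_le : S.tauMin q / S.T q ≤ tauHat z ^ 2 / (S.f q * S.T q) := by
  have h := (Real.sqrt_le_left (Y.tauHat_pos hz).le).1 hz.2.2.2.2.2.1
  have hf := S.f_pos q
  have hT := S.T_pos q
  rw [div_le_div_iff₀ hT (S.fT_pos q)]
  nlinarith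

lemma Y.tau_lt_one : tauHat z ^ 2 / (S.f q * S.T q) < 1 := by
  have h := Real.le_sqrt' (Y.tauHat_pos hz) |>.1 hz.2.2.2.2.2.2
  rw [div_lt_one (S.fT_pos q)]
  have := mul_lt_mul_of_pos_right (S.tauMax_lt q) (S.f_pos q)
  linarith

lemma Y.tau_factor_pos : 0 < 1 - tauHat z ^ 2 / (S.f q * S.T q) :=
  sub_pos.2 (Y.tau_lt_one hz)

lemma Y.pfa_factor_pos : 0 < 1 - pfa z := sub_pos.2 (Y.pfa_lt_one hz)

lemma Y.gaussQinv_nonneg : 0 ≤ gaussQinv (pfa z) :=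
  CognitiveRadio.gaussQinv_nonneg (Y.pfa_pos hz) (Y.pfa_le_half hz)

/-- Since `α ≤ 1/2`, the detection bound `𝒬⁻¹(1 - α)` is nonpositive. This sign makes the missed
detection probability convex and also bounds `𝒬⁻¹(P^fa)` from above. -/
lemma Y.missArg_nonpos (k : Fin N) :
    (S.s0 q k * gaussQinv (pfa z) - (S.mu1 q k - S.mu0 q k) * tauHat z) / S.s1 q k ≤ 0 := by
  have h1 := hz.2.2.1 k
  have h2 : gaussQinv (1 - S.alpha q k) ≤ 0 :=
    gaussQinv_nonpos (by linarith [S.alpha_le q k]) (by linarith [S.alpha_pos q k])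
  calc _ = S.s0 q k / S.s1 q k * gaussQinv (pfa z) -
        tauHat z * ((S.mu1 q k - S.mu0 q k) / S.s1 q k) := by ring
    _ ≤ 0 := h1.trans h2

lemma Y.gaussQinv_le (k : Fin N) :
    gaussQinv (pfa z) ≤ (S.mu1 q k - S.mu0 q k) * S.tauHatMax q / S.s0 q k := by
  have h := Y.missArg_nonpos hz k
  rw [div_le_iff₀ (S.s1_pos q k), zero_mul] at h
  rw [le_div_iff₀ (S.s0_pos q k)]
  have := mul_le_mul_of_nonneg_left (Y.tauHat_le hz) (S.delta_pos q k).le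
  linarith

lemma Y.pfaMin_le [NeZero N] : S.pfaMin q ≤ pfa z := by
  refine (ciInf_le (Set.finite_range _).bddBelow (0 : Fin N)).trans ?_
  rw [← gaussQinv_le_iff (Y.pfa_pos hz) (Y.pfa_lt_one hz)]
  exact Y.gaussQinv_le hz 0

omit hz

lemma effNoise_pos (hx : ∀ r, r ≠ q → x r ∈ S.Y r) (k : Fin N) : 0 < S.effNoise q x k :=
  add_pos_of_pos_of_nonneg (S.noiseHat_pos q k) <| Finset.sum_nonneg fun r hr =>
    mul_nonneg (S.gainHat_nonneg q r k)
      (Y.power_nonneg (hx r (Finset.ne_of_mem_erase hr)) k)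

include hz

lemma one_le_rate_arg (hx : ∀ r, r ≠ q → x r ∈ S.Y r) (k : Fin N) :
    1 ≤ 1 + power z k / S.effNoise q x k :=
  le_add_of_nonneg_right (div_nonneg (Y.power_nonneg hz k) (effNoise_pos hx k).le)

lemma sumRate_pos (hx : ∀ r, r ≠ q → x r ∈ S.Y r) (hp : power z ≠ 0) :
    0 < S.sumRate q x z := by
  obtain ⟨k, hk⟩ := Function.ne_iff.1 hp
  refine Finset.sum_pos' (fun k _ => Real.log_nonneg (one_le_rate_arg hz hx k))
    ⟨k, Finset.mem_univ k, Real.log_pos ?_⟩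
  exact lt_add_of_pos_right _
    (div_pos (lt_of_le_of_ne (Y.power_nonneg hz k) (Ne.symm hk)) (effNoise_pos hx k))

lemma throughput_update_pos (hx : ∀ r, r ≠ q → x r ∈ S.Y r) (hp : power z ≠ 0) :
    0 < S.throughput q (Function.update x q z) := by
  rw [throughput_update]
  exact mul_pos (mul_pos (Y.tau_factor_pos hz) (Y.pfa_factor_pos hz)) (sumRate_pos hz hx hp)

lemma sumRate_le (hx : ∀ r, r ≠ q → x r ∈ S.Y r) : S.sumRate q x z ≤ S.rMax q := by
  refine Finset.sum_le_sum fun k _ => Real.log_le_log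
    (zero_lt_one.trans_le (one_le_rate_arg hz hx k)) ?_
  have h1 : S.noiseHat q k ≤ S.effNoise q x k :=
    le_add_of_nonneg_right <| Finset.sum_nonneg fun r hr =>
      mul_nonneg (S.gainHat_nonneg q r k)
        (Y.power_nonneg (hx r (Finset.ne_of_mem_erase hr)) k)
  have := S.noiseHat_pos q k
  have := Y.power_le hz k
  have := (S.pMax_pos q k).le
  gcongr

lemma effNoise_add_power_le (hx : ∀ r, r ≠ q → x r ∈ S.Y r) (k : Fin N) :
    S.effNoise q x k + power z k ≤ S.noiseHat q k + ∑ r, S.gainHat q r k * S.pMax r k := by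
  unfold effNoise
  rw [← Finset.add_sum_erase _ _ (Finset.mem_univ q), gainHat_self, one_mul]
  have h1 := Y.power_le hz k
  have h2 : ∑ r ∈ Finset.univ.erase q, S.gainHat q r k * power (x r) k ≤
      ∑ r ∈ Finset.univ.erase q, S.gainHat q r k * S.pMax r k :=
    Finset.sum_le_sum fun r hr => mul_le_mul_of_nonneg_left
      (Y.power_le (hx r (Finset.ne_of_mem_erase hr)) k) (S.gainHat_nonneg q r k)
  linarith

lemma contDiffAt_pMiss (k : Fin N) :
    ContDiffAt ℝ 2 (fun y : Strategy N => S.pMiss q k (pfa y) (tauHat y)) z := by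
  have h1 : ContDiffAt ℝ 2 (fun y : Strategy N => gaussQinv (pfa y)) z :=
    (contDiffAt_gaussQinv (Y.pfa_pos hz) (Y.pfa_lt_one hz)).comp z contDiff_pfa.contDiffAt
  have h2 : ContDiffAt ℝ 2 (fun y : Strategy N => (S.s0 q k * gaussQinv (pfa y) -
      (S.mu1 q k - S.mu0 q k) * tauHat y) / S.s1 q k) z :=
    ((contDiffAt_const.mul h1).sub
      (contDiffAt_const.mul contDiff_tauHat.contDiffAt)).div_const _
  exact contDiffAt_const.sub (contDiff_gaussQ.contDiffAt.comp z h2)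

lemma contDiffAt_leak : ContDiffAt ℝ 2 (S.leak q) z :=
  ContDiffAt.sum fun k _ =>
    ((contDiffAt_pMiss hz k).mul contDiffAt_const).mul (contDiff_power k).contDiffAt

lemma contDiffAt_throughput (hx : ∀ r, r ≠ q → x r ∈ S.Y r) :
    ContDiffAt ℝ 2 (fun y => S.throughput q (Function.update x q y)) z := by
  simp only [throughput_update]
  refine ContDiffAt.mul (ContDiffAt.mul ?_ ?_) (ContDiffAt.sum fun k _ => ContDiffAt.log ?_ ?_)
  · exact contDiffAt_const.sub ((contDiff_tauHat.contDiffAt.pow 2).div_const _)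
  · exact contDiffAt_const.sub contDiff_pfa.contDiffAt
  · exact contDiffAt_const.add ((contDiff_power k).contDiffAt.div_const _)
  · exact (zero_lt_one.trans_le (one_le_rate_arg hz hx k)).ne'

omit hz

lemma contDiff_penalty : ContDiff ℝ 2 (S.penalty q x) :=
  contDiff_const.mul (((contDiff_const.mul contDiff_tauHat).sub contDiff_const).pow 2)

include hz

lemma contDiffAt_lagrangian (hx : ∀ r, r ≠ q → x r ∈ S.Y r) (hp : power z ≠ 0)
    (price lam : ℝ) : ContDiffAt ℝ 2 (S.lagrangian q x price lam) z := by
  have e : S.lagrangian q x price lam = fun z => _ :=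
    funext fun z => lagrangian_eq S q x price lam z
  rw [e]
  exact ((((contDiffAt_throughput hz hx).log (throughput_update_pos hz hx hp).ne').neg.add
    contDiff_penalty.contDiffAt).add (contDiffAt_const.mul (contDiffAt_leak hz))).add
    contDiffAt_const

end Y

end System

/-! ### Curvature of each term along lines. -/

lemma HasSecondDerivAt.congr_of_eventuallyEq {f g : ℝ → ℝ} {f₁ f₂ x : ℝ}
    (h : HasSecondDerivAt f f₁ f₂ x) (e : g =ᶠ[𝓝 x] f) : HasSecondDerivAt g f₁ f₂ x := by
  obtain ⟨f', hf, h1, h2⟩ := h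
  refine ⟨f', ?_, h1, h2⟩
  filter_upwards [hf, e.eventually_nhds] with s a b using a.congr_of_eventuallyEq b

namespace System

variable {Q N : ℕ} {S : System Q N} {q : Fin Q} {x : Fin Q → Strategy N} {z : Strategy N}

/-- Along lines the missed detection probability has nonnegative second derivative. -/
lemma pMiss_line (hz : z ∈ S.Y q) (k : Fin N) (a b : ℝ) : ∃ m₁ m₂ : ℝ,
    HasSecondDerivAt (fun s => S.pMiss q k (pfa z + s * b) (tauHat z + s * a)) m₁ m₂ 0 ∧
      |m₁| ≤ S.omTau q k * |a| + S.omPfa q k * |b| ∧ 0 ≤ m₂ := by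
  have hv0 := Y.gaussQinv_nonneg hz
  have hu0 := Y.missArg_nonpos hz k
  have hs0 := S.s0_pos q k
  have hs1 := S.s1_pos q k
  have hd := S.delta_pos q k
  set v := gaussQinv (pfa z) with hv
  set D := S.mu1 q k - S.mu0 q k with hD
  set u := (S.s0 q k * v - D * tauHat z) / S.s1 q k with hu
  have hφv := gaussPhi_pos v
  have hφu := gaussPhi_pos u
  have hinv : HasSecondDerivAt (fun s => gaussQinv (pfa z + s * b)) (-(gaussPhi v)⁻¹ * b)
      (v * (gaussPhi v)⁻¹ ^ 2 * b ^ 2) 0 := by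
    have e : pfa z + 0 * b = pfa z := by ring
    have h := (HasSecondDerivAt.comp (f := fun s => pfa z + s * b) (g := gaussQinv) (x := 0)
      (by rw [e]; exact hasSecondDerivAt_gaussQinv (Y.pfa_pos hz) (Y.pfa_lt_one hz))
      (.affine _ b 0))
    exact h.congr rfl (by simp [hv])
  have harg := ((hinv.const_mul (S.s0 q k)).add
    ((HasSecondDerivAt.affine (tauHat z) a 0).const_mul (-D))).const_mul (S.s1 q k)⁻¹
  have hval : (S.s1 q k)⁻¹ * (S.s0 q k * gaussQinv (pfa z + 0 * b) +
      -D * (tauHat z + 0 * a)) = u := by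
    rw [hu, hv]; simp only [zero_mul, add_zero]; ring
  have hm := (HasSecondDerivAt.comp (g := gaussQ) (by
    simp only [hval]; exact hasSecondDerivAt_gaussQ u) harg).const_sub 1
  refine ⟨_, _, hm.congr_of_eventuallyEq (Eventually.of_forall fun s => ?_), ?_, ?_⟩
  · simp only [pMiss, ← hD]
    congr 2
    ring
  · have e : -(-gaussPhi u * ((S.s1 q k)⁻¹ * (S.s0 q k * (-(gaussPhi v)⁻¹ * b) + -D * a))) =
        -(S.s0 q k / S.s1 q k * (gaussPhi u / gaussPhi v) * b + gaussPhi u * (D / S.s1 q k) * a)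
        := by ring
    rw [e, abs_neg]
    refine (abs_add_le _ _).trans ?_
    rw [add_comm, abs_mul (gaussPhi u * _) a, abs_mul (_ * _) b, abs_of_nonneg (by positivity : 0 ≤ gaussPhi u * (D / S.s1 q k)),
      abs_of_nonneg (by positivity : 0 ≤ S.s0 q k / S.s1 q k * (gaussPhi u / gaussPhi v))]
    have h1 := gaussPhi_le u
    have h2 : gaussPhi u / gaussPhi v ≤ Real.exp ((D / S.s0 q k * S.tauHatMax q) ^ 2 / 2) := by
      refine (gaussPhi_div_le u v).trans (Real.exp_le_exp.2 ?_)
      have h3 : v ≤ D / S.s0 q k * S.tauHatMax q := (Y.gaussQinv_le hz k).trans_eq (by ring)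
      have h4 : v ^ 2 ≤ (D / S.s0 q k * S.tauHatMax q) ^ 2 := pow_le_pow_left₀ hv0 h3 2
      linarith
    unfold omTau omPfa
    gcongr
  -- Convexity by composition: `1 - 𝒬` is increasing, and convex on the negative axis where `u`
  -- lies, while `𝒬⁻¹` is convex at `P^fa ≤ 1/2`, where `v ≥ 0`.
  · have h3 : 0 ≤ -u := by linarith
    have : ∀ t : ℝ, -(u * gaussPhi u * t ^ 2 + -gaussPhi u * ((S.s1 q k)⁻¹ *
        (S.s0 q k * (v * (gaussPhi v)⁻¹ ^ 2 * b ^ 2) + -D * 0))) =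
        -u * gaussPhi u * t ^ 2 + gaussPhi u * ((S.s1 q k)⁻¹ *
        (S.s0 q k * (v * (gaussPhi v)⁻¹ ^ 2 * b ^ 2))) := fun t => by ring
    rw [this]
    positivity

lemma omTau_pos (k : Fin N) : 0 < S.omTau q k := by
  have := S.s1_pos q k
  have := S.delta_pos q k
  unfold omTau; positivity

lemma omPfa_pos (k : Fin N) : 0 < S.omPfa q k := by
  have := S.s1_pos q k
  have := S.s0_pos q k
  unfold omPfa; positivity

/-- In the product rule for `P^miss · w · p` the power is affine, and the term with the second
derivative of `P^miss` is nonnegative. Only twice the product of first derivatives remains to be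
bounded. -/
lemma leak_line (hz : z ∈ S.Y q) (v : Strategy N) : ∃ f₁ f₂ : ℝ,
    HasSecondDerivAt (fun s : ℝ => S.leak q (z + s • v)) f₁ f₂ 0 ∧
      -(2 * ∑ k, S.w q k * ((S.omTau q k * |tauHat v| + S.omPfa q k * |pfa v|) * |power v k|))
        ≤ f₂ := by
  choose m₁ m₂ hm h1 h2 using fun k => pMiss_line hz k (tauHat v) (pfa v)
  have hk := fun k => ((hm k).mul (.const (S.w q k) 0)).mul
    (.affine (power z k) (power v k) 0)
  refine ⟨_, _, (HasSecondDerivAt.sum Finset.univ fun k _ => hk k), ?_⟩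
  rw [Finset.mul_sum, ← Finset.sum_neg_distrib]
  refine Finset.sum_le_sum fun k _ => ?_
  simp only [mul_zero, add_zero, zero_mul]
  have hw := S.w_nonneg q k
  have hp := Y.power_nonneg hz k
  have h3 : 0 ≤ m₂ k * S.w q k * power z k := mul_nonneg (mul_nonneg (h2 k) hw) hp
  have h4 : -(|m₁ k| * |power v k|) ≤ m₁ k * power v k := by
    rw [← abs_mul]; exact neg_abs_le _
  have h5 := mul_le_mul_of_nonneg_right (h1 k) (abs_nonneg (power v k))
  have h6 := mul_le_mul_of_nonneg_left (h5.trans' (neg_le.1 h4)) hw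
  linarith

/-- With `A = f T` and `y = τ̂²/A`, the second derivative is `(2/A)(1 + y)/(1 - y)² a²`. It
increases with `y`, and `y ≥ τ^min/T`. -/
lemma neg_log_tau_line (hz : z ∈ S.Y q) (a : ℝ) : ∃ f₁ f₂ : ℝ,
    HasSecondDerivAt (fun s => -Real.log (1 - (tauHat z + s * a) ^ 2 / (S.f q * S.T q)))
      f₁ f₂ 0 ∧ S.dMin q (Sum.inl ()) * a ^ 2 ≤ f₂ := by
  have hA := S.fT_pos q
  have hpos := Y.tau_factor_pos hz
  have hmin := Y.tauMin_le hz
  set A := S.f q * S.T q with hAdef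
  have hg := (((HasSecondDerivAt.affine (tauHat z) a 0).mul
    (.affine (tauHat z) a 0)).const_mul A⁻¹).const_sub 1
  have hval : 1 - A⁻¹ * ((tauHat z + 0 * a) * (tauHat z + 0 * a)) = 1 - tauHat z ^ 2 / A := by
    ring
  have hl := (hg.log (by rw [hval]; exact hpos)).neg
  simp only [hval] at hl
  refine ⟨_, _, hl.congr_of_eventuallyEq (Eventually.of_forall fun s => ?_), ?_⟩
  · simp only
    congr 3
    ring
  · have hy0 : 0 ≤ S.tauMin q / S.T q := (div_pos (S.tauMin_pos q) (S.T_pos q)).le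
    have hy : tauHat z ^ 2 = A * (tauHat z ^ 2 / A) := by field_simp
    set y := tauHat z ^ 2 / A with hydef
    set y0 := S.tauMin q / S.T q with hy0def
    have hrw : ∀ g : ℝ, g = 1 - y → -(-(A⁻¹ * (0 * (tauHat z + 0 * a) + 2 * (a * a) +
        (tauHat z + 0 * a) * 0)) / g - (-(A⁻¹ * (a * (tauHat z + 0 * a) +
        (tauHat z + 0 * a) * a)) / g) ^ 2) = 2 / A * ((1 + y) / (1 - y) ^ 2) * a ^ 2 := by
      rintro g rfl
      have h1 : (-(A⁻¹ * (a * (tauHat z + 0 * a) + (tauHat z + 0 * a) * a)) / (1 - y)) ^ 2 =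
          4 * A⁻¹ ^ 2 * a ^ 2 * tauHat z ^ 2 / (1 - y) ^ 2 := by
        rw [div_pow]; ring
      rw [h1, hy]
      have := hpos.ne'
      field_simp
      ring
    rw [hrw _ rfl]
    have hmono : (1 + y0) / (1 - y0) ^ 2 ≤ (1 + y) / (1 - y) ^ 2 := by
      have : 0 < 1 - y := hpos
      gcongr
    have h2 := mul_le_mul_of_nonneg_right (mul_le_mul_of_nonneg_left hmono
      (by positivity : 0 ≤ 2 / A)) (sq_nonneg a)
    refine le_trans (le_of_eq ?_) h2
    unfold dMin
    ring

lemma neg_log_pfa_line [NeZero N] (hz : z ∈ S.Y q) (b : ℝ) : ∃ f₁ f₂ : ℝ,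
    HasSecondDerivAt (fun s => -Real.log (1 - (pfa z + s * b))) f₁ f₂ 0 ∧
      S.dMin q (Sum.inr (Sum.inr ())) * b ^ 2 ≤ f₂ := by
  have hpos := Y.pfa_factor_pos hz
  have hmin := Y.pfaMin_le hz
  have hval : 1 - (pfa z + 0 * b) = 1 - pfa z := by ring
  have hl := (((HasSecondDerivAt.affine (pfa z) b 0).const_sub 1).log
    (by rw [hval]; exact hpos)).neg
  refine ⟨_, _, hl, ?_⟩
  rw [hval]
  have h : 1 / (1 - S.pfaMin q) ^ 2 ≤ 1 / (1 - pfa z) ^ 2 := by gcongr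
  have h2 := mul_le_mul_of_nonneg_right h (sq_nonneg b)
  unfold dMin
  refine h2.trans (le_of_eq ?_)
  rw [div_pow]; ring

/-- For the sum rate `R`, `(-log R)'' = -R''/R + (R'/R)²`. The square is dropped; `-R''` is a sum of
squares over the carriers, and `R ≤ r^max` together with the largest noise plus interference bounds
it below. -/
lemma neg_log_sumRate_line (hz : z ∈ S.Y q) (hx : ∀ r, r ≠ q → x r ∈ S.Y r)
    (hp : power z ≠ 0) (v : Strategy N) : ∃ f₁ f₂ : ℝ,
    HasSecondDerivAt (fun s : ℝ => -Real.log (S.sumRate q x (z + s • v))) f₁ f₂ 0 ∧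
      ∑ k, S.dMin q (Sum.inr (Sum.inl k)) * power v k ^ 2 ≤ f₂ := by
  have hR := sumRate_pos hz hx hp
  have hn := fun k => effNoise_pos hx k
  have hk : ∀ k, HasSecondDerivAt (fun s : ℝ => Real.log (1 + power (z + s • v) k /
      S.effNoise q x k)) (power v k / (S.effNoise q x k + power z k))
      (-(power v k / (S.effNoise q x k + power z k)) ^ 2) 0 := by
    intro k
    have h1 := one_le_rate_arg hz hx k
    have h := (HasSecondDerivAt.affine (1 + power z k / S.effNoise q x k)
      (power v k / S.effNoise q x k) 0).log (by rw [zero_mul]; linarith)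
    have e1 : power v k / S.effNoise q x k /
        (1 + power z k / S.effNoise q x k + 0 * (power v k / S.effNoise q x k)) =
        power v k / (S.effNoise q x k + power z k) := by
      have := (hn k).ne'
      rw [zero_mul, add_zero]
      field_simp
    rw [e1, zero_div, zero_sub] at h
    refine h.congr_of_eventuallyEq (Eventually.of_forall fun s => ?_)
    simp only [power, Pi.add_apply, Pi.smul_apply, smul_eq_mul]
    congr 1; ring
  have hs := HasSecondDerivAt.sum Finset.univ fun k _ => hk k
  have hval : ∑ k, Real.log (1 + power (z + (0 : ℝ) • v) k / S.effNoise q x k) =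
      S.sumRate q x z := by simp [sumRate]
  have hl := (hs.log (by rw [hval]; exact hR)).neg
  refine ⟨_, _, hl, ?_⟩
  rw [hval, neg_sub]
  have h1 : ∑ k, S.dMin q (Sum.inr (Sum.inl k)) * power v k ^ 2 ≤
      -((∑ k, -(power v k / (S.effNoise q x k + power z k)) ^ 2) / S.sumRate q x z) := by
    rw [Finset.sum_neg_distrib, neg_div, neg_neg, Finset.sum_div]
    refine Finset.sum_le_sum fun k _ => ?_
    have hRle := sumRate_le hz hx
    have hnle := effNoise_add_power_le hz hx k
    have hpos : 0 < S.effNoise q x k + power z k :=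
      add_pos_of_pos_of_nonneg (hn k) (Y.power_nonneg hz k)
    unfold dMin
    calc 1 / S.rMax q / (S.noiseHat q k + ∑ r, S.gainHat q r k * S.pMax r k) ^ 2 *
          power v k ^ 2
        ≤ 1 / S.sumRate q x z / (S.effNoise q x k + power z k) ^ 2 * power v k ^ 2 := by
          gcongr
      _ = _ := by rw [div_pow]; ring
  have h2 := sq_nonneg ((∑ k, power v k / (S.effNoise q x k + power z k)) / S.sumRate q x z)
  linarith

lemma penalty_line (v : Strategy N) : ∃ f₁ f₂ : ℝ,
    HasSecondDerivAt (fun s : ℝ => S.penalty q x (z + s • v)) f₁ f₂ 0 ∧ 0 ≤ f₂ := by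
  obtain ⟨A, hA⟩ : ∃ A, A = 1 / Real.sqrt (S.f q) - 1 / (Q : ℝ) * (1 / Real.sqrt (S.f q)) :=
    ⟨_, rfl⟩
  obtain ⟨B, hB⟩ : ∃ B, B = 1 / (Q : ℝ) * ∑ r ∈ Finset.univ.erase q,
    tauHat (x r) / Real.sqrt (S.f r) := ⟨_, rfl⟩
  have h : HasSecondDerivAt (fun s => A * tauHat z - B + s * (A * tauHat v)) _ _ 0 :=
    .affine _ _ 0
  refine ⟨_, _, ((h.mul h).const_mul (S.c / 2)).congr_of_eventuallyEq
    (Eventually.of_forall fun s => ?_), ?_⟩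
  · have e : tauHat (z + s • v) = tauHat z + s * tauHat v := rfl
    simp only [penalty, e, ← hA, ← hB]
    ring
  · have := S.c_nonneg
    have h2 := mul_self_nonneg (A * tauHat v)
    simp only [zero_mul, mul_zero, zero_add, add_zero]
    positivity

/-- The interference weight `W` is dominated by the curvature of the throughput. -/
def CurvatureDominates (S : System Q N) (q : Fin Q) (W : ℝ) : Prop :=
  W * ∑ k, S.omTau q k < S.dMin q (Sum.inl ()) ∧
    (∀ k, W * (S.omTau q k + S.omPfa q k) < S.dMin q (Sum.inr (Sum.inl k))) ∧
    W * ∑ k, S.omPfa q k < S.dMin q (Sum.inr (Sum.inr ()))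

/-- Diagonal dominance: `2|a||b| ≤ a² + b²` distributes every cross term over the two squares
involved, and the strict inequalities leave a positive multiple of each squared coordinate. -/
lemma curvature_pos {W : ℝ} (hW0 : 0 ≤ W) (hW : S.CurvatureDominates q W) {v : Strategy N}
    (hv : v ≠ 0) :
    0 < S.dMin q (Sum.inl ()) * tauHat v ^ 2 +
      S.dMin q (Sum.inr (Sum.inr ())) * pfa v ^ 2 +
      ∑ k, S.dMin q (Sum.inr (Sum.inl k)) * power v k ^ 2 -
      2 * ∑ k, W * ((S.omTau q k * |tauHat v| + S.omPfa q k * |pfa v|) * |power v k|) := by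
  obtain ⟨h1, h2, h3⟩ := hW
  have key : 2 * ∑ k, W * ((S.omTau q k * |tauHat v| + S.omPfa q k * |pfa v|) * |power v k|) ≤
      (W * ∑ k, S.omTau q k) * tauHat v ^ 2 + (W * ∑ k, S.omPfa q k) * pfa v ^ 2 +
        ∑ k, (W * (S.omTau q k + S.omPfa q k)) * power v k ^ 2 := by
    simp only [Finset.mul_sum, Finset.sum_mul, ← Finset.sum_add_distrib]
    refine Finset.sum_le_sum fun k _ => ?_
    have ht := mul_nonneg (mul_nonneg hW0 (S.omTau_pos (q := q) k).le)
      (sq_nonneg (|tauHat v| - |power v k|))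
    have hp := mul_nonneg (mul_nonneg hW0 (S.omPfa_pos (q := q) k).le)
      (sq_nonneg (|pfa v| - |power v k|))
    rw [sub_sq, sq_abs, sq_abs] at ht hp
    linarith
  have t1 : 0 ≤ (S.dMin q (Sum.inl ()) - W * ∑ k, S.omTau q k) * tauHat v ^ 2 :=
    mul_nonneg (sub_pos.2 h1).le (sq_nonneg _)
  have t2 : 0 ≤ (S.dMin q (Sum.inr (Sum.inr ())) - W * ∑ k, S.omPfa q k) * pfa v ^ 2 :=
    mul_nonneg (sub_pos.2 h3).le (sq_nonneg _)
  have t3 : ∀ k ∈ Finset.univ, 0 ≤ (S.dMin q (Sum.inr (Sum.inl k)) -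
      W * (S.omTau q k + S.omPfa q k)) * power v k ^ 2 := fun k _ =>
    mul_nonneg (sub_pos.2 (h2 k)).le (sq_nonneg _)
  have hsum : ∑ k, (S.dMin q (Sum.inr (Sum.inl k)) -
      W * (S.omTau q k + S.omPfa q k)) * power v k ^ 2 =
      ∑ k, S.dMin q (Sum.inr (Sum.inl k)) * power v k ^ 2 -
        ∑ k, (W * (S.omTau q k + S.omPfa q k)) * power v k ^ 2 := by
    rw [← Finset.sum_sub_distrib]
    exact Finset.sum_congr rfl fun k _ => by ring
  have t3' := Finset.sum_nonneg t3
  obtain ⟨i, hi⟩ := Function.ne_iff.1 hv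
  rcases i with i | k | i
  · have : 0 < (S.dMin q (Sum.inl ()) - W * ∑ k, S.omTau q k) * tauHat v ^ 2 :=
      mul_pos (sub_pos.2 h1) (sq_pos_of_ne_zero hi)
    linarith
  · have : 0 < ∑ k, (S.dMin q (Sum.inr (Sum.inl k)) -
        W * (S.omTau q k + S.omPfa q k)) * power v k ^ 2 :=
      Finset.sum_pos' t3 ⟨k, Finset.mem_univ k, mul_pos (sub_pos.2 (h2 k)) (sq_pos_of_ne_zero hi)⟩
    linarith
  · have : 0 < (S.dMin q (Sum.inr (Sum.inr ())) - W * ∑ k, S.omPfa q k) * pfa v ^ 2 :=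
      mul_pos (sub_pos.2 h3) (sq_pos_of_ne_zero hi)
    linarith

theorem hasPosDefHessianAt_lagrangian [NeZero N] {W price lam : ℝ}
    (hW0 : 0 ≤ W) (hW : S.CurvatureDominates q W) (hK : 0 ≤ lam + price)
    (hKW : ∀ k, (lam + price) * S.w q k ≤ W)
    (hz : z ∈ S.Y q) (hx : ∀ r, r ≠ q → x r ∈ S.Y r) (hp : power z ≠ 0) :
    HasPosDefHessianAt (S.lagrangian q x price lam) z := by
  refine hasPosDefHessianAt_of_line (contDiffAt_lagrangian hz hx hp price lam) fun v hv => ?_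
  obtain ⟨_, t₂, ht, ht2⟩ := neg_log_tau_line hz (tauHat v)
  obtain ⟨_, b₂, hb, hb2⟩ := neg_log_pfa_line hz (pfa v)
  obtain ⟨_, r₂, hr, hr2⟩ := neg_log_sumRate_line hz hx hp v
  obtain ⟨_, c₂, hc, hc2⟩ := penalty_line (S := S) (q := q) (x := x) (z := z) v
  obtain ⟨_, l₂, hl, hl2⟩ := leak_line hz v
  have hsum := ((((ht.add hb).add hr).add hc).add (hl.const_mul (lam + price))).add
    (.const (price * (S.othersLeak q x - S.IGlob) - lam * S.ILoc q) 0)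
  refine ⟨_, _, hsum.congr_of_eventuallyEq ?_, ?_⟩
  · have hline : Tendsto (fun s : ℝ => z + s • v) (𝓝 0) (𝓝 z) := by
      have : Continuous fun s : ℝ => z + s • v := by fun_prop
      simpa using this.tendsto 0
    -- The logarithm of the throughput splits into three logarithms only where the product is
    -- nonzero; positivity at `z` persists for small `s`.
    have hthr := (contDiffAt_throughput hz hx).continuousAt.eventually
      (lt_mem_nhds (throughput_update_pos hz hx hp))
    filter_upwards [hline.eventually hthr] with s hs
    rw [lagrangian_eq]
    rw [throughput_update] at hs ⊢
    have h1 := left_ne_zero_of_mul hs.ne'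
    rw [Real.log_mul h1 (right_ne_zero_of_mul hs.ne'),
      Real.log_mul (left_ne_zero_of_mul h1) (right_ne_zero_of_mul h1)]
    have e1 : tauHat (z + s • v) = tauHat z + s * tauHat v := rfl
    have e2 : pfa (z + s • v) = pfa z + s * pfa v := rfl
    rw [e1, e2]
    ring
  · have hcv := curvature_pos hW0 hW hv
    have h1 : (lam + price) * ∑ k, S.w q k *
        ((S.omTau q k * |tauHat v| + S.omPfa q k * |pfa v|) * |power v k|) ≤
        ∑ k, W * ((S.omTau q k * |tauHat v| + S.omPfa q k * |pfa v|) * |power v k|) := by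
      rw [Finset.mul_sum]
      refine Finset.sum_le_sum fun k _ => ?_
      rw [← mul_assoc]
      have := S.omTau_pos (q := q) k
      have := S.omPfa_pos (q := q) k
      exact mul_le_mul_of_nonneg_right (hKW k) (by positivity)
    have h2 := mul_le_mul_of_nonneg_left hl2 hK
    linarith

end System

lemma iInf_pos_of_finite {ι : Type*} [Finite ι] [Nonempty ι] {f : ι → ℝ} (h : ∀ i, 0 < f i) :
    0 < ⨅ i, f i := by
  obtain ⟨i, hi⟩ := exists_eq_ciInf_of_finite (f := f)
  rw [← hi]; exact h i

/-- The strategy `z` with its power vector replaced by `p`. -/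
def withPower {N : ℕ} (z : Strategy N) (p : Fin N → ℝ) : Strategy N
  | Sum.inl _ => tauHat z
  | Sum.inr (Sum.inl k) => p k
  | Sum.inr (Sum.inr _) => pfa z

namespace System

variable {Q N : ℕ} {S : System Q N} {q : Fin Q} {x : Fin Q → Strategy N} {z : Strategy N}

/-! ### The constants `λ^max` and `γ^(1)`. -/

section Constants

lemma log_one_add_div_le {a n : ℝ} (ha : 0 < a) (hn : 0 < n) :
    1 / a * Real.log (1 + a / n) ≤ 1 / n := by
  have h := Real.log_le_sub_one_of_pos (show 0 < 1 + a / n by positivity)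
  have h1 : Real.log (1 + a / n) ≤ a / n := by linarith
  calc _ ≤ 1 / a * (a / n) := by gcongr
    _ = 1 / n := by field_simp

/-- The `q`-th summand already suffices: its numerator is at least `1/I_q^max`, and its denominator
is at most `1` because `log(1 + a/n)/a ≤ 1/n`. The other summands are nonnegative. -/
lemma one_div_ILoc_le_lamMax [NeZero N] : 1 / S.ILoc q ≤ S.lamMax := by
  have : Nonempty (Fin Q) := ⟨q⟩
  have hinf : 0 < ⨅ r : Fin Q, min (S.ILoc r) (⨅ k : Fin N, S.pMax r k) :=
    iInf_pos_of_finite fun r => lt_min (S.ILoc_pos r) (iInf_pos_of_finite (S.pMax_pos r))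
  have hn : ∀ (q : Fin Q) (k : Fin N), 0 ≤
      ∑ r ∈ Finset.univ.erase q, ‖S.H q r k‖ ^ 2 * S.pMax r k := fun q k =>
    Finset.sum_nonneg fun r _ => mul_nonneg (sq_nonneg _) (S.pMax_pos r k).le
  have hden : ∀ q : Fin Q, 0 < (⨅ k : Fin N, 1 / S.pMax q k * Real.log (1 + S.pMax q k /
      (S.noise q k + ∑ r ∈ Finset.univ.erase q, ‖S.H q r k‖ ^ 2 * S.pMax r k))) *
        ⨅ k : Fin N, S.noise q k := fun q => by
    refine mul_pos (iInf_pos_of_finite fun k => ?_) (iInf_pos_of_finite (S.noise_pos q))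
    have h1 := S.pMax_pos q k
    have h2 := add_pos_of_pos_of_nonneg (S.noise_pos q k) (hn q k)
    exact mul_pos (by positivity) (Real.log_pos (lt_add_of_pos_right _ (by positivity)))
  refine le_trans ?_ (Finset.single_le_sum (fun r _ => ?_) (Finset.mem_univ q))
  · have hle : (⨅ k : Fin N, 1 / S.pMax q k * Real.log (1 + S.pMax q k /
        (S.noise q k + ∑ r ∈ Finset.univ.erase q, ‖S.H q r k‖ ^ 2 * S.pMax r k))) *
        (⨅ k : Fin N, S.noise q k) ≤ 1 := by
      have h1 := ciInf_le (Set.finite_range fun k => 1 / S.pMax q k * Real.log (1 + S.pMax q k /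
        (S.noise q k + ∑ r ∈ Finset.univ.erase q, ‖S.H q r k‖ ^ 2 * S.pMax r k))).bddBelow
        (0 : Fin N)
      have h2 := ciInf_le (Set.finite_range fun k => S.noise q k).bddBelow (0 : Fin N)
      have hσ := S.noise_pos q 0
      have h3 : 1 / S.pMax q 0 * Real.log (1 + S.pMax q 0 /
          (S.noise q 0 + ∑ r ∈ Finset.univ.erase q, ‖S.H q r 0‖ ^ 2 * S.pMax r 0)) ≤
          1 / S.noise q 0 :=
        (log_one_add_div_le (S.pMax_pos q 0)
          (add_pos_of_pos_of_nonneg hσ (hn q 0))).trans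
          (one_div_le_one_div_of_le hσ (le_add_of_nonneg_right (hn q 0)))
      calc _ ≤ 1 / S.noise q 0 * S.noise q 0 :=
            mul_le_mul (h1.trans h3) h2 (Real.iInf_nonneg fun k => (S.noise_pos q k).le)
              (by positivity)
        _ = 1 := by field_simp
    have hI : ⨅ r : Fin Q, min (S.ILoc r) (⨅ k : Fin N, S.pMax r k) ≤ S.ILoc q :=
      (ciInf_le (Set.finite_range _).bddBelow q).trans (min_le_left _ _)
    refine (one_div_le_one_div_of_le hinf hI).trans ?_
    exact le_div_self (by positivity) (hden q) hle
  · exact div_nonneg (by positivity) (hden r).le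

lemma sum_offUp_tau : ∑ j, S.offUp q (Sum.inl ()) j =
    ∑ k, 2 * S.omTau q k + 2 * ∑ k, S.omTauPfa q k * S.pMax q k := by
  simp [Fintype.sum_sum_type, offUp]

lemma sum_offUp_power (k : Fin N) : ∑ j, S.offUp q (Sum.inr (Sum.inl k)) j =
    2 * S.omTau q k + 2 * S.omPfa q k := by
  simp [Fintype.sum_sum_type, offUp]

lemma sum_offUp_pfa : ∑ j, S.offUp q (Sum.inr (Sum.inr ())) j =
    2 * ∑ k, S.omTauPfa q k * S.pMax q k + ∑ k, 2 * S.omPfa q k := by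
  simp [Fintype.sum_sum_type, offUp]

lemma sum_omTauPfa_nonneg : 0 ≤ ∑ k, S.omTauPfa q k * S.pMax q k := by
  refine Finset.sum_nonneg fun k _ => mul_nonneg (mul_nonneg ?_ (Real.exp_pos _).le)
    (S.pMax_pos q k).le
  exact le_max_of_le_left (gaussQinv_nonneg (S.alpha_pos q k) (S.alpha_le q k))

lemma sum_offUp_pos [NeZero N] (i : Coord N) : 0 < ∑ j, S.offUp q i j := by
  have h := S.sum_omTauPfa_nonneg (q := q)
  have hne : (Finset.univ : Finset (Fin N)).Nonempty := Finset.univ_nonempty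
  rcases i with i | k | i
  · rw [show i = () from rfl, sum_offUp_tau]
    have : 0 < ∑ k, 2 * S.omTau q k :=
      Finset.sum_pos (fun k _ => mul_pos two_pos (omTau_pos k)) hne
    linarith
  · rw [sum_offUp_power]
    linarith [S.omTau_pos (q := q) k, S.omPfa_pos (q := q) k]
  · rw [show i = () from rfl, sum_offUp_pfa]
    have : 0 < ∑ k, 2 * S.omPfa q k :=
      Finset.sum_pos (fun k _ => mul_pos two_pos (omPfa_pos k)) hne
    linarith

lemma pfaMin_lt_one [NeZero N] : S.pfaMin q < 1 :=
  (ciInf_le (Set.finite_range _).bddBelow (0 : Fin N)).trans_lt (gaussQ_lt_one _)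

lemma dMin_pos [NeZero N] (i : Coord N) : 0 < S.dMin q i := by
  rcases i with i | k | i
  · have h1 := S.T_pos q
    have h2 := S.f_pos q
    have h3 := S.tauMin_pos q
    have h4 : S.tauMin q / S.T q < 1 :=
      (div_lt_one h1).2 ((S.tauMin_lt q).trans (S.tauMax_lt q))
    have h5 : 0 < 1 - S.tauMin q / S.T q := sub_pos.2 h4
    unfold dMin; positivity
  · have h1 : 0 < S.rMax q := Finset.sum_pos (fun k _ => Real.log_pos
      (lt_add_of_pos_right _ (div_pos (S.pMax_pos q k) (S.noiseHat_pos q k))))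
      Finset.univ_nonempty
    have h2 : 0 < S.noiseHat q k + ∑ r, S.gainHat q r k * S.pMax r k :=
      add_pos_of_pos_of_nonneg (S.noiseHat_pos q k) (Finset.sum_nonneg fun r _ =>
        mul_nonneg (S.gainHat_nonneg q r k) (S.pMax_pos r k).le)
    unfold dMin; positivity
  · have h : 0 < 1 - S.pfaMin q := sub_pos.2 S.pfaMin_lt_one
    unfold dMin; positivity

lemma iInf_ratio_pos [NeZero N] : 0 < ⨅ i : Coord N, S.dMin q i / ∑ j, S.offUp q i j :=
  iInf_pos_of_finite fun i => div_pos (dMin_pos i) (sum_offUp_pos i)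

lemma gamma1_pos [NeZero N] {t Itot : ℝ} (ht : 0 < t) (hI : 0 < Itot) :
    0 < S.gamma1 q t Itot :=
  div_pos (mul_pos hI (mul_pos two_pos (lt_max_of_lt_left ht))) iInf_ratio_pos

/-- The row sums of `offUp` exceed what is needed: they carry a factor `2` and the nonnegative
`τ̂`–`P^fa` entries, which convexity of `P^miss` makes superfluous. -/
lemma curvatureDominates_of_lt [NeZero N] {W : ℝ} (hW : 0 ≤ W)
    (h : W < ⨅ i : Coord N, S.dMin q i / ∑ j, S.offUp q i j) : S.CurvatureDominates q W := by
  have key : ∀ i, W * ∑ j, S.offUp q i j < S.dMin q i := fun i => by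
    rw [← lt_div_iff₀ (sum_offUp_pos i)]
    exact h.trans_le (ciInf_le (Set.finite_range _).bddBelow i)
  have h0 := S.sum_omTauPfa_nonneg (q := q)
  have hτ : 0 ≤ ∑ k, S.omTau q k := Finset.sum_nonneg fun k _ => (omTau_pos k).le
  have hP : 0 ≤ ∑ k, S.omPfa q k := Finset.sum_nonneg fun k _ => (omPfa_pos k).le
  refine ⟨lt_of_le_of_lt (mul_le_mul_of_nonneg_left ?_ hW) (key _), fun k =>
    lt_of_le_of_lt (mul_le_mul_of_nonneg_left ?_ hW) (key _),
    lt_of_le_of_lt (mul_le_mul_of_nonneg_left ?_ hW) (key _)⟩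
  · rw [sum_offUp_tau, ← Finset.mul_sum]; linarith
  · rw [sum_offUp_power]
    linarith [S.omTau_pos (q := q) k, S.omPfa_pos (q := q) k]
  · rw [sum_offUp_pfa, ← Finset.mul_sum]; linarith

/-- The witness is `2 max(t, λ^max)` times the largest weight, with `Itot` cancelling; the
hypothesis on `γ` says exactly that it lies below the smallest ratio `d_i / ∑_j M_ij`. -/
lemma exists_curvatureDominates [NeZero N] {t Itot : ℝ} (ht : 0 < t) (hI : 0 < Itot)
    (h : S.gamma1 q t Itot * (⨆ k : Fin N, ‖S.G q k‖ ^ 2 / Itot) < 1) :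
    ∃ W, 0 ≤ W ∧ S.CurvatureDominates q W ∧ ∀ K, K ≤ 2 * max t S.lamMax →
      ∀ k, K * S.w q k ≤ W := by
  have hm : 0 < 2 * max t S.lamMax := mul_pos two_pos (lt_max_of_lt_left ht)
  have hs : 0 ≤ ⨆ k : Fin N, ‖S.G q k‖ ^ 2 / Itot := Real.iSup_nonneg fun k => by positivity
  have hW : 0 ≤ Itot * (2 * max t S.lamMax) * ⨆ k : Fin N, ‖S.G q k‖ ^ 2 / Itot := by positivity
  refine ⟨_, hW, curvatureDominates_of_lt hW ?_, fun K hK k => ?_⟩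
  · unfold gamma1 at h
    rwa [div_mul_eq_mul_div, div_lt_one iInf_ratio_pos] at h
  · have h1 := le_ciSup (Set.finite_range fun k => ‖S.G q k‖ ^ 2 / Itot).bddAbove k
    rw [div_le_iff₀ hI] at h1
    calc K * S.w q k ≤ (2 * max t S.lamMax) * S.w q k :=
          mul_le_mul_of_nonneg_right hK (S.w_nonneg q k)
      _ ≤ (2 * max t S.lamMax) * ((⨆ k : Fin N, ‖S.G q k‖ ^ 2 / Itot) * Itot) :=
          mul_le_mul_of_nonneg_left h1 hm.le
      _ = _ := by ring

end Constants

/-! ### Compactness and convexity of `𝒴_q`. -/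

section StrategySet

/-- Membership in `𝒴_q` with the detection constraint expressed through `𝒬`. -/
lemma mem_Y_iff [NeZero N] : z ∈ S.Y q ↔ pfa z ≤ S.beta q ∧
    (∀ k, gaussQ ((tauHat z * (S.mu1 q k - S.mu0 q k) +
      S.s1 q k * gaussQinv (1 - S.alpha q k)) / S.s0 q k) ≤ pfa z) ∧
    ∑ k, power z k ≤ S.budget q ∧ (∀ k, 0 ≤ power z k) ∧ (∀ k, power z k ≤ S.pMax q k) ∧
    Real.sqrt (S.tauMin q * S.f q) ≤ tauHat z ∧ tauHat z ≤ Real.sqrt (S.tauMax q * S.f q) := by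
  have key : 0 < pfa z → pfa z ≤ S.beta q → ∀ k,
      (S.s0 q k / S.s1 q k * gaussQinv (pfa z) -
        tauHat z * ((S.mu1 q k - S.mu0 q k) / S.s1 q k) ≤ gaussQinv (1 - S.alpha q k) ↔
      gaussQ ((tauHat z * (S.mu1 q k - S.mu0 q k) +
        S.s1 q k * gaussQinv (1 - S.alpha q k)) / S.s0 q k) ≤ pfa z) := by
    intro h0 h1 k
    rw [← gaussQinv_le_iff h0 (by linarith [S.beta_le q]), le_div_iff₀ (S.s0_pos q k),
      ← mul_le_mul_iff_right₀ (S.s1_pos q k)]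
    have h2 := (S.s1_pos q k).ne'
    have e : S.s1 q k * (S.s0 q k / S.s1 q k * gaussQinv (pfa z) -
        tauHat z * ((S.mu1 q k - S.mu0 q k) / S.s1 q k)) =
        gaussQinv (pfa z) * S.s0 q k - tauHat z * (S.mu1 q k - S.mu0 q k) := by
      field_simp
    rw [e]
    constructor <;> intro h <;> linarith
  constructor
  · rintro ⟨h0, h1, h2, h3, h4, h5⟩
    exact ⟨h1, fun k => (key h0 h1 k).1 (h2 k), h3, fun k => (h4 k).1, fun k => (h4 k).2, h5⟩
  · rintro ⟨h1, h2, h3, h4, h4', h5⟩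
    -- The open condition `0 < P^fa` is implied by the closed detection constraint on one carrier,
    -- which is why the set is closed.
    have h0 : 0 < pfa z := (gaussQ_pos _).trans_le (h2 0)
    exact ⟨h0, h1, fun k => (key h0 h1 k).2 (h2 k), h3, fun k => ⟨h4 k, h4' k⟩, h5⟩

lemma isClosed_Y [NeZero N] : IsClosed (S.Y q) := by
  have e : S.Y q = {z | pfa z ≤ S.beta q ∧ _} := Set.ext fun z => mem_Y_iff
  rw [e]
  have hτ : Continuous (tauHat : Strategy N → ℝ) := (contDiff_tauHat (n := 0)).continuous
  have hP : Continuous (pfa : Strategy N → ℝ) := (contDiff_pfa (n := 0)).continuous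
  have hp : ∀ k, Continuous fun z : Strategy N => power z k := fun k =>
    (contDiff_power (n := 0) k).continuous
  have hQ := continuous_gaussQ
  simp only [Set.ofPred_and, Set.ofPred_forall]
  refine (isClosed_le hP continuous_const).inter
    ((isClosed_iInter fun k => isClosed_le (hQ.comp ?_) hP).inter
    ((isClosed_le (continuous_finsetSum _ fun k _ => hp k) continuous_const).inter
    ((isClosed_iInter fun k => isClosed_le continuous_const (hp k)).inter
    ((isClosed_iInter fun k => isClosed_le (hp k) continuous_const).inter
    ((isClosed_le continuous_const hτ).inter (isClosed_le hτ continuous_const))))))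
  exact ((hτ.mul continuous_const).add continuous_const).div_const _

lemma isCompact_Y [NeZero N] : IsCompact (S.Y q) := by
  let u : Strategy N := fun
    | Sum.inl _ => S.tauHatMax q
    | Sum.inr (Sum.inl k) => S.pMax q k
    | Sum.inr (Sum.inr _) => 1
  refine isCompact_Icc.of_isClosed_subset (s := Set.Icc 0 u) isClosed_Y
    fun z hz => ⟨fun i => ?_, fun i => ?_⟩
  · rcases i with i | k | i
    · exact (Y.tauHat_pos hz).le
    · exact Y.power_nonneg hz k
    · exact (Y.pfa_pos hz).le
  · rcases i with i | k | i
    · exact Y.tauHat_le hz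
    · exact Y.power_le hz k
    · exact (Y.pfa_lt_one hz).le

/-- The detection constraint places `P^fa` above `𝒬` of an affine function of `τ̂`. On `𝒴_q` that
function is at least `𝒬⁻¹(P^fa) ≥ 0`, so it takes values where `𝒬` is convex. -/
lemma convex_Y [NeZero N] : Convex ℝ (S.Y q) := by
  intro y hy z hz a b ha hb hab
  have harg : ∀ {y : Strategy N}, y ∈ S.Y q → ∀ k, 0 ≤ (tauHat y * (S.mu1 q k - S.mu0 q k) +
      S.s1 q k * gaussQinv (1 - S.alpha q k)) / S.s0 q k := fun {y} hy k => by
    have h1 := (mem_Y_iff.1 hy).2.1 k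
    rw [← gaussQinv_le_iff (Y.pfa_pos hy) (Y.pfa_lt_one hy)] at h1
    exact (Y.gaussQinv_nonneg hy).trans h1
  have hy' := mem_Y_iff.1 hy
  have hz' := mem_Y_iff.1 hz
  obtain ⟨y1, y2, y3, y4, y5, y6, y7⟩ := hy'
  obtain ⟨z1, z2, z3, z4, z5, z6, z7⟩ := hz'
  have eτ : tauHat (a • y + b • z) = a * tauHat y + b * tauHat z := rfl
  have eP : pfa (a • y + b • z) = a * pfa y + b * pfa z := rfl
  have ep : ∀ k, power (a • y + b • z) k = a * power y k + b * power z k := fun _ => rfl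
  have comb : ∀ {s t c : ℝ}, s ≤ c → t ≤ c → a * s + b * t ≤ c := fun {s t c} h1 h2 => by
    have := convex_Iic c h1 h2 ha hb hab
    simpa using this
  have comb' : ∀ {s t c : ℝ}, c ≤ s → c ≤ t → c ≤ a * s + b * t := fun {s t c} h1 h2 => by
    have := convex_Ici c h1 h2 ha hb hab
    simpa using this
  rw [mem_Y_iff, eτ, eP]
  simp only [ep]
  refine ⟨comb y1 z1, fun k => ?_, ?_, fun k => comb' (y4 k) (z4 k), fun k => comb (y5 k) (z5 k),
    comb' y6 z6, comb y7 z7⟩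
  · have hc := convexOn_gaussQ.2 (harg hy k) (harg hz k) ha hb hab
    simp only [smul_eq_mul] at hc
    have e : ((a * tauHat y + b * tauHat z) * (S.mu1 q k - S.mu0 q k) +
        S.s1 q k * gaussQinv (1 - S.alpha q k)) / S.s0 q k =
        a * ((tauHat y * (S.mu1 q k - S.mu0 q k) +
          S.s1 q k * gaussQinv (1 - S.alpha q k)) / S.s0 q k) +
        b * ((tauHat z * (S.mu1 q k - S.mu0 q k) +
          S.s1 q k * gaussQinv (1 - S.alpha q k)) / S.s0 q k) := by
      obtain rfl : b = 1 - a := by linarith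
      ring
    rw [e]
    exact hc.trans (add_le_add (mul_le_mul_of_nonneg_left (y2 k) ha)
      (mul_le_mul_of_nonneg_left (z2 k) hb))
  · rw [Finset.sum_add_distrib, ← Finset.mul_sum, ← Finset.mul_sum]
    exact comb y3 z3

lemma convex_Y_power_ne_zero [NeZero N] : Convex ℝ {z | z ∈ S.Y q ∧ power z ≠ 0} := by
  refine convex_iff_forall_pos.2 fun y hy z hz a b ha hb hab =>
    ⟨convex_Y hy.1 hz.1 ha.le hb.le hab, ?_⟩
  obtain ⟨k, hk⟩ := Function.ne_iff.1 hy.2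
  have h1 : 0 < power y k := lt_of_le_of_ne (Y.power_nonneg hy.1 k) (Ne.symm hk)
  have h2 := Y.power_nonneg hz.1 k
  refine Function.ne_iff.2 ⟨k, ne_of_gt ?_⟩
  change 0 < a * power y k + b * power z k
  positivity

lemma withPower_mem_Y (hz : z ∈ S.Y q) {p : Fin N → ℝ} (hsum : ∑ k, p k ≤ S.budget q)
    (hp : ∀ k, 0 ≤ p k ∧ p k ≤ S.pMax q k) : withPower z p ∈ S.Y q :=
  ⟨hz.1, hz.2.1, hz.2.2.1, hsum, hp, hz.2.2.2.2.2⟩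

lemma exists_mem_Y_power_ne_zero [NeZero N] (h : (S.Y q).Nonempty) :
    ∃ z ∈ S.Y q, power z ≠ 0 := by
  obtain ⟨z, hz⟩ := h
  have hN : (0 : ℝ) < N := Nat.cast_pos.2 (NeZero.pos N)
  have hb := div_pos (S.budget_pos q) hN
  -- The budget is split equally over the carriers and capped by the mask.
  refine ⟨withPower z fun k => min (S.pMax q k) (S.budget q / N), withPower_mem_Y hz ?_ fun k =>
    ⟨(lt_min (S.pMax_pos q k) hb).le, min_le_left _ _⟩,
    Function.ne_iff.2 ⟨0, (lt_min (S.pMax_pos q 0) hb).ne'⟩⟩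
  calc ∑ k, min (S.pMax q k) (S.budget q / N) ≤ ∑ _k : Fin N, S.budget q / N :=
        Finset.sum_le_sum fun k _ => min_le_right _ _
    _ = S.budget q := by simp; field_simp

end StrategySet

end System

/-! ### Duality for the local interference constraint. -/

namespace System

variable {Q N : ℕ} (S : System Q N) (q : Fin Q) (x : Fin Q → Strategy N)

/-- The exponential of the negative Lagrangian, up to a positive factor independent of the own
strategy; it is continuous also where the throughput vanishes. -/
def expNegLagrangian (price lam : ℝ) (z : Strategy N) : ℝ :=
  S.throughput q (Function.update x q z) *
    Real.exp (-S.penalty q x z - (lam + price) * S.leak q z)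

/-- Pairs of a multiplier in `[0, Λ]` and a maximizer over `𝒴_q` for this multiplier. -/
def multiplierMaximizers (price Λ : ℝ) : Set (ℝ × Strategy N) :=
  {p ∈ Set.Icc 0 Λ ×ˢ S.Y q | ∀ y ∈ S.Y q,
    S.expNegLagrangian q x price p.1 y ≤ S.expNegLagrangian q x price p.1 p.2}

variable {S q x} {z : Strategy N}

lemma throughput_update_of_power_eq_zero (h : power z = 0) :
    S.throughput q (Function.update x q z) = 0 := by
  rw [throughput_update]
  simp [sumRate, h]

lemma expNegLagrangian_pos (hz : z ∈ S.Y q) (hx : ∀ r, r ≠ q → x r ∈ S.Y r)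
    (hp : power z ≠ 0) (price lam : ℝ) : 0 < S.expNegLagrangian q x price lam z :=
  mul_pos (throughput_update_pos hz hx hp) (Real.exp_pos _)

lemma log_expNegLagrangian (hz : z ∈ S.Y q) (hx : ∀ r, r ≠ q → x r ∈ S.Y r)
    (hp : power z ≠ 0) (price lam : ℝ) :
    Real.log (S.expNegLagrangian q x price lam z) = -S.lagrangian q x price lam z +
      (price * (S.othersLeak q x - S.IGlob) - lam * S.ILoc q) := by
  unfold expNegLagrangian
  rw [Real.log_mul (throughput_update_pos hz hx hp).ne' (Real.exp_pos _).ne', Real.log_exp,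
    lagrangian_eq]
  ring

lemma continuousOn_expNegLagrangian (hx : ∀ r, r ≠ q → x r ∈ S.Y r) (price : ℝ)
    (s : Set ℝ) : ContinuousOn (fun p : ℝ × Strategy N => S.expNegLagrangian q x price p.1 p.2)
      (s ×ˢ S.Y q) := by
  intro p hp
  refine ContinuousAt.continuousWithinAt ?_
  have h1 : ContinuousAt (fun p : ℝ × Strategy N =>
      S.throughput q (Function.update x q p.2)) p :=
    ContinuousAt.comp (f := Prod.snd) (g := fun y => S.throughput q (Function.update x q y))
      (contDiffAt_throughput hp.2 hx).continuousAt continuousAt_snd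
  have h2 : ContinuousAt (fun p : ℝ × Strategy N => S.leak q p.2) p :=
    ContinuousAt.comp (f := Prod.snd) (contDiffAt_leak hp.2).continuousAt continuousAt_snd
  have h3 : ContinuousAt (fun p : ℝ × Strategy N => S.penalty q x p.2) p :=
    ContinuousAt.comp (f := Prod.snd) contDiff_penalty.continuous.continuousAt continuousAt_snd
  exact h1.mul (Real.continuous_exp.continuousAt.comp
    (h3.neg.sub ((continuousAt_fst.add continuousAt_const).mul h2)))

lemma isCompact_multiplierMaximizers [NeZero N] (hx : ∀ r, r ≠ q → x r ∈ S.Y r)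
    (price Λ : ℝ) : IsCompact (S.multiplierMaximizers q x price Λ) := by
  have hK : IsCompact (Set.Icc 0 Λ ×ˢ S.Y q) := isCompact_Icc.prod isCompact_Y
  have hF := continuousOn_expNegLagrangian hx price (Set.Icc 0 Λ)
  refine hK.of_isClosed_subset ?_ fun p hp => hp.1
  have e : S.multiplierMaximizers q x price Λ = (Set.Icc 0 Λ ×ˢ S.Y q) ∩
      ⋂ y ∈ S.Y q, {p ∈ Set.Icc 0 Λ ×ˢ S.Y q |
        S.expNegLagrangian q x price p.1 y ≤ S.expNegLagrangian q x price p.1 p.2} := by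
    ext p
    simp only [multiplierMaximizers, Set.mem_ofPred_eq, Set.mem_inter_iff, Set.mem_iInter]
    exact ⟨fun h => ⟨h.1, fun y hy => ⟨h.1, h.2 y hy⟩⟩, fun h => ⟨h.1, fun y hy => (h.2 y hy).2⟩⟩
  rw [e]
  refine hK.isClosed.inter (isClosed_biInter fun y hy => ?_)
  refine hK.isClosed.isClosed_le (ContinuousOn.comp
    (g := fun p : ℝ × Strategy N => S.expNegLagrangian q x price p.1 p.2)
    (f := fun p : ℝ × Strategy N => (p.1, y)) hF ?_ fun p hp => ⟨hp.1, hy⟩) hF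
  fun_prop

lemma exists_mem_multiplierMaximizers [NeZero N] (hne : (S.Y q).Nonempty)
    (hx : ∀ r, r ≠ q → x r ∈ S.Y r) (price : ℝ) {Λ lam : ℝ} (hlam : lam ∈ Set.Icc 0 Λ) :
    ∃ z, (lam, z) ∈ S.multiplierMaximizers q x price Λ := by
  have hc : ContinuousOn (S.expNegLagrangian q x price lam) (S.Y q) :=
    ContinuousOn.comp (g := fun p : ℝ × Strategy N => S.expNegLagrangian q x price p.1 p.2)
      (f := fun z : Strategy N => (lam, z))
      (continuousOn_expNegLagrangian hx price (Set.Icc 0 Λ)) (by fun_prop)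
      fun z hz => ⟨hlam, hz⟩
  obtain ⟨z, hz, hmax⟩ := isCompact_Y.exists_isMaxOn hne hc
  exact ⟨z, ⟨hlam, hz⟩, hmax⟩

/-- The maximized function vanishes at zero power and is positive at some point of `𝒴_q`. -/
lemma power_ne_zero_of_mem_multiplierMaximizers [NeZero N]
    (hx : ∀ r, r ≠ q → x r ∈ S.Y r) {price Λ lam : ℝ}
    (h : (lam, z) ∈ S.multiplierMaximizers q x price Λ) : power z ≠ 0 := by
  intro h0
  obtain ⟨y, hy, hyp⟩ := exists_mem_Y_power_ne_zero ⟨z, h.1.2⟩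
  have h1 := (expNegLagrangian_pos hy hx hyp price lam).trans_le (h.2 y hy)
  simp [expNegLagrangian, throughput_update_of_power_eq_zero h0] at h1

lemma isMinOn_of_mem_multiplierMaximizers [NeZero N]
    (hx : ∀ r, r ≠ q → x r ∈ S.Y r) {price Λ lam : ℝ}
    (h : (lam, z) ∈ S.multiplierMaximizers q x price Λ) :
    IsMinOn (S.lagrangian q x price lam) {z | z ∈ S.Y q ∧ power z ≠ 0} z := by
  intro y hy
  have hp := power_ne_zero_of_mem_multiplierMaximizers hx h
  have h1 := Real.log_le_log (expNegLagrangian_pos hy.1 hx hy.2 price lam) (h.2 y hy.1)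
  simp only at h1
  rw [log_expNegLagrangian hy.1 hx hy.2, log_expNegLagrangian h.1.2 hx hp] at h1
  simp only [Set.mem_ofPred_eq]
  linarith

/-- Bernoulli's inequality `(1 + y)^s ≤ 1 + s y`, after taking logarithms. -/
lemma mul_log_le_log_one_add_mul {s y : ℝ} (hs0 : 0 ≤ s) (hs1 : s ≤ 1) (hy : 0 ≤ y) :
    s * Real.log (1 + y) ≤ Real.log (1 + s * y) := by
  rw [← Real.log_rpow (by linarith)]
  exact Real.log_le_log (Real.rpow_pos_of_pos (by linarith) _)
    (rpow_one_add_le_one_add_mul_self (by linarith) hs0 hs1)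

lemma mul_throughput_le (hz : z ∈ S.Y q) (hx : ∀ r, r ≠ q → x r ∈ S.Y r) {s : ℝ}
    (hs0 : 0 ≤ s) (hs1 : s ≤ 1) : s * S.throughput q (Function.update x q z) ≤
      S.throughput q (Function.update x q (withPower z fun k => s * power z k)) := by
  have hR : s * S.sumRate q x z ≤ S.sumRate q x (withPower z fun k => s * power z k) := by
    unfold sumRate
    rw [Finset.mul_sum]
    refine Finset.sum_le_sum fun k _ => ?_
    have h := mul_log_le_log_one_add_mul hs0 hs1
      (div_nonneg (Y.power_nonneg hz k) (effNoise_pos hx k).le)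
    rwa [← mul_div_assoc] at h
  rw [throughput_update, throughput_update]
  change s * ((1 - tauHat z ^ 2 / (S.f q * S.T q)) * (1 - pfa z) * S.sumRate q x z) ≤
    (1 - tauHat z ^ 2 / (S.f q * S.T q)) * (1 - pfa z) *
      S.sumRate q x (withPower z fun k => s * power z k)
  have := mul_le_mul_of_nonneg_left hR
    (mul_pos (Y.tau_factor_pos hz) (Y.pfa_factor_pos hz)).le
  linarith

/-- At a maximizer the weighted interference is at most one. -/
lemma mul_leak_le_one [NeZero N] (hx : ∀ r, r ≠ q → x r ∈ S.Y r) {price Λ lam : ℝ}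
    (h : (lam, z) ∈ S.multiplierMaximizers q x price Λ) :
    (lam + price) * S.leak q z ≤ 1 := by
  have hz : z ∈ S.Y q := h.1.2
  have hthr := throughput_update_pos hz hx (power_ne_zero_of_mem_multiplierMaximizers hx h)
  set K := (lam + price) * S.leak q z with hK
  -- Scaling the powers by `s` stays in `𝒴_q`, multiplies the interference by `s` and keeps at least
  -- the fraction `s` of the throughput. Maximality gives `s · exp((1 - s)K) ≤ 1`; then `exp u ≥ 1 +
  -- u` applies, and `1 - s` cancels.
  have key : ∀ s : ℝ, 0 < s → s < 1 → s * K ≤ 1 := by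
    intro s hs0 hs1
    have hp : ∀ k, s * power z k ≤ power z k := fun k =>
      mul_le_of_le_one_left (Y.power_nonneg hz k) hs1.le
    have hmem : withPower z (fun k => s * power z k) ∈ S.Y q :=
      withPower_mem_Y hz ((Finset.sum_le_sum fun k _ => hp k).trans hz.2.2.2.1) fun k =>
        ⟨mul_nonneg hs0.le (Y.power_nonneg hz k), (hp k).trans (Y.power_le hz k)⟩
    have h1 := h.2 _ hmem
    have eleak : S.leak q (withPower z fun k => s * power z k) = s * S.leak q z := by
      unfold leak
      rw [Finset.mul_sum]
      refine Finset.sum_congr rfl fun k _ => ?_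
      change S.pMiss q k (pfa z) (tauHat z) * S.w q k * (s * power z k) = _
      ring
    have epen : S.penalty q x (withPower z fun k => s * power z k) = S.penalty q x z := rfl
    unfold expNegLagrangian at h1
    simp only [eleak, epen] at h1
    have h2 := (mul_le_mul_of_nonneg_right (mul_throughput_le hz hx hs0.le hs1.le)
      (Real.exp_pos _).le).trans h1
    have e : -S.penalty q x z - (lam + price) * (s * S.leak q z) =
        (1 - s) * K + (-S.penalty q x z - K) := by rw [hK]; ring
    rw [e, Real.exp_add] at h2
    have hE := Real.exp_pos (-S.penalty q x z - K)
    have h3 : s * Real.exp ((1 - s) * K) ≤ 1 := by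
      refine le_of_mul_le_mul_right ?_ (mul_pos hthr hE)
      linarith
    have h4 := mul_le_mul_of_nonneg_left (Real.add_one_le_exp ((1 - s) * K)) hs0.le
    have h5 : (1 - s) * (s * K) ≤ (1 - s) * 1 := by linarith
    exact le_of_mul_le_mul_left h5 (sub_pos.2 hs1)
  by_contra! hlt
  have hs : 1 / K < 1 := (div_lt_one (by linarith)).2 hlt
  obtain ⟨s, h1, h2⟩ := exists_between hs
  have h3 := key s (lt_trans (by positivity) h1) h2
  rw [div_lt_iff₀ (by linarith)] at h1
  linarith

/-- A maximizer satisfying the interference constraint with complementary slackness. -/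
lemma exists_complementary [NeZero N] (hne : (S.Y q).Nonempty)
    (hx : ∀ r, r ≠ q → x r ∈ S.Y r) {price : ℝ} (hprice : 0 ≤ price)
    (hconv : ∀ lam ∈ Set.Icc 0 (1 / S.ILoc q), StrictConvexOn ℝ {z | z ∈ S.Y q ∧ power z ≠ 0}
      (S.lagrangian q x price lam)) :
    ∃ lam z, (lam, z) ∈ S.multiplierMaximizers q x price (1 / S.ILoc q) ∧
      S.locViol q z ≤ 0 ∧ lam * S.locViol q z = 0 := by
  have hI := S.ILoc_pos q
  set Λ := 1 / S.ILoc q with hΛ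
  have hΛ0 : 0 < Λ := by positivity
  set G := S.multiplierMaximizers q x price Λ with hG
  have hGc : IsCompact G := isCompact_multiplierMaximizers hx price Λ
  have hv : ContinuousOn (fun p : ℝ × Strategy N => S.locViol q p.2) G := fun p hp =>
    (ContinuousAt.comp (f := Prod.snd) (g := S.locViol q)
      ((contDiffAt_leak hp.1.2).sub contDiffAt_const).continuousAt
      continuousAt_snd).continuousWithinAt
  have hA : IsClosed (Prod.fst '' {p ∈ G | S.locViol q p.2 ≤ 0}) :=
    ((hGc.of_isClosed_subset (hGc.isClosed.isClosed_le hv continuousOn_const)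
      fun p hp => hp.1).image continuous_fst).isClosed
  have hB : IsClosed (Prod.fst '' {p ∈ G | 0 ≤ S.locViol q p.2}) :=
    ((hGc.of_isClosed_subset (hGc.isClosed.isClosed_le continuousOn_const hv)
      fun p hp => hp.1).image continuous_fst).isClosed
  have hex : ∀ lam ∈ Set.Icc 0 Λ, ∃ z, (lam, z) ∈ G := fun lam hlam =>
    exists_mem_multiplierMaximizers hne hx price hlam
  obtain ⟨z0, hz0⟩ := hex 0 ⟨le_rfl, hΛ0.le⟩
  obtain ⟨z1, hz1⟩ := hex Λ ⟨hΛ0.le, le_rfl⟩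
  by_cases h0 : S.locViol q z0 ≤ 0
  · exact ⟨0, z0, hz0, h0, zero_mul _⟩
  -- At `Λ = 1/I_q^max` the bound of `mul_leak_le_one` is the constraint itself, since the price
  -- contributes a nonnegative amount.
  have hle : S.locViol q z1 ≤ 0 := by
    have h1 := mul_leak_le_one hx hz1
    have h2 : 0 ≤ S.leak q z1 := Finset.sum_nonneg fun k _ =>
      mul_nonneg (mul_nonneg (S.pMiss_nonneg q k _ _) (S.w_nonneg q k))
        (Y.power_nonneg hz1.1.2 k)
    have h3 : Λ * S.leak q z1 ≤ 1 := by
      have := mul_nonneg hprice h2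
      linarith
    rw [hΛ, one_div, inv_mul_le_iff₀ hI] at h3
    rw [locViol_eq]; linarith
  -- The multipliers admitting a maximizer with violation `≤ 0` and those admitting one with
  -- violation `≥ 0` form closed sets covering the interval, with `Λ` in the first and `0` in the
  -- second. By connectedness they meet; uniqueness then merges the two maximizers into one with
  -- violation zero.
  obtain ⟨lam, hlam, ⟨⟨_, u⟩, ⟨huG, hu⟩, rfl⟩, ⟨⟨_, v⟩, ⟨hvG, hv'⟩, hlv⟩⟩ :=
    isPreconnected_closed_iff.1 (isPreconnected_Icc (a := 0) (b := Λ)) _ _ hA hB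
      (fun lam hlam => by
        obtain ⟨z, hz⟩ := hex lam hlam
        rcases le_total (S.locViol q z) 0 with h | h
        · exact Or.inl ⟨(lam, z), ⟨hz, h⟩, rfl⟩
        · exact Or.inr ⟨(lam, z), ⟨hz, h⟩, rfl⟩)
      ⟨Λ, ⟨hΛ0.le, le_rfl⟩, (Λ, z1), ⟨hz1, hle⟩, rfl⟩
      ⟨0, ⟨le_rfl, hΛ0.le⟩, (0, z0), ⟨hz0, (not_le.1 h0).le⟩, rfl⟩
  simp only at hlam hlv hu hv'
  subst hlv
  obtain rfl : u = v := (hconv _ hlam).eq_of_isMinOn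
    (isMinOn_of_mem_multiplierMaximizers hx huG) (isMinOn_of_mem_multiplierMaximizers hx hvG)
    ⟨huG.1.2, power_ne_zero_of_mem_multiplierMaximizers hx huG⟩
    ⟨hvG.1.2, power_ne_zero_of_mem_multiplierMaximizers hx hvG⟩
  exact ⟨_, u, huG, hu, by rw [le_antisymm hu hv', mul_zero]⟩

lemma objective_of_power_ne_zero (hz : z ∈ S.Y q) (hx : ∀ r, r ≠ q → x r ∈ S.Y r)
    (hp : power z ≠ 0) (price lam : ℝ) : S.objective q x price z =
      ((-S.lagrangian q x price lam z + lam * S.locViol q z : ℝ) : EReal) := by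
  unfold objective
  rw [if_pos (throughput_update_pos hz hx hp)]
  congr 1
  unfold lagrangian
  ring

lemma objective_of_power_eq_zero (hp : power z = 0) (price : ℝ) :
    S.objective q x price z = ⊥ := by
  unfold objective
  rw [if_neg (by rw [throughput_update_of_power_eq_zero hp]; exact lt_irrefl 0)]

/-- Where the power is nonzero, the objective is `-L + λ I_q`. On `𝒳_q` it is therefore at most
`-L`, with equality at the complementary point, so no convexity of `𝒳_q` is needed. -/
theorem existsUnique_bestResponse [NeZero N] (hne : (S.Y q).Nonempty)
    (hx : ∀ r, r ≠ q → x r ∈ S.Y r) {price : ℝ} (hprice : 0 ≤ price)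
    (hconv : ∀ lam ∈ Set.Icc 0 (1 / S.ILoc q), StrictConvexOn ℝ {z | z ∈ S.Y q ∧ power z ≠ 0}
      (S.lagrangian q x price lam)) :
    ∃ z, S.IsBestResponse q x price z ∧ power z ≠ 0 ∧
      ∀ z', S.IsBestResponse q x price z' → z' = z := by
  obtain ⟨lam, z, hG, hle, hcomp⟩ := exists_complementary hne hx hprice hconv
  have hz : z ∈ S.Y q := hG.1.2
  have hp := power_ne_zero_of_mem_multiplierMaximizers hx hG
  have hmin := isMinOn_of_mem_multiplierMaximizers hx hG
  have hobj := objective_of_power_ne_zero hz hx hp price lam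
  rw [hcomp, add_zero] at hobj
  have hlam0 : 0 ≤ lam := hG.1.1.1
  refine ⟨z, ⟨⟨hz, hle⟩, fun y hy => ?_⟩, hp, fun y hy => ?_⟩
  · simp only [Set.mem_ofPred_eq]
    by_cases hyp : power y = 0
    · rw [objective_of_power_eq_zero hyp]; exact bot_le
    · rw [objective_of_power_ne_zero hy.1 hx hyp price lam, hobj, EReal.coe_le_coe_iff]
      have h1 : S.lagrangian q x price lam z ≤ S.lagrangian q x price lam y := hmin ⟨hy.1, hyp⟩
      have h2 := mul_nonpos_of_nonneg_of_nonpos hlam0 hy.2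
      linarith
  · have h1 : S.objective q x price z ≤ S.objective q x price y := hy.2 ⟨hz, hle⟩
    have hyp : power y ≠ 0 := fun h0 => by
      rw [objective_of_power_eq_zero h0, hobj] at h1
      exact EReal.coe_ne_bot _ (le_bot_iff.1 h1)
    rw [objective_of_power_ne_zero hy.1.1 hx hyp price lam, hobj, EReal.coe_le_coe_iff] at h1
    have h2 := mul_nonpos_of_nonneg_of_nonpos hlam0 hy.1.2
    -- Another best response also minimizes the Lagrangian for this `lam`, and a strictly convex
    -- function has at most one minimizer.
    have hle' : S.lagrangian q x price lam y ≤ S.lagrangian q x price lam z := by linarith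
    exact (hconv lam hG.1.1).eq_of_isMinOn (fun w hw => hle'.trans (hmin hw)) hmin
      ⟨hy.1.1, hyp⟩ ⟨hz, hp⟩

end System

end CognitiveRadio

end

theorem corollary1 {Q N : ℕ} (hN : 0 < N) (S : CognitiveRadio.System Q N) (q : Fin Q)
    (hfeas : (S.X q).Nonempty) (t : ℝ) (ht : 0 < t) (Itot : ℝ) (hItot : 0 < Itot) :
    0 < S.gamma1 q t Itot ∧
    (S.gamma1 q t Itot * (⨆ k : Fin N, ‖S.G q k‖ ^ 2 / Itot) < 1 →
      ∀ x : Fin Q → CognitiveRadio.Strategy N, (∀ r, r ≠ q → x r ∈ S.Y r) →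
      ∀ price : ℝ, 0 ≤ price → price ≤ t →
        (∀ z ∈ S.Y q, CognitiveRadio.power z ≠ 0 →
          ∀ lam : ℝ, 0 ≤ lam → lam ≤ S.lamMax →
            CognitiveRadio.HasPosDefHessianAt (S.lagrangian q x price lam) z) ∧
        ∃ z, S.IsBestResponse q x price z ∧ CognitiveRadio.power z ≠ 0 ∧
          ∀ z', S.IsBestResponse q x price z' → z' = z) := by
  have : NeZero N := ⟨hN.ne'⟩
  refine ⟨CognitiveRadio.System.gamma1_pos ht hItot, fun h x hx price hprice0 hprice => ?_⟩
  obtain ⟨W, hW0, hW, hWK⟩ := CognitiveRadio.System.exists_curvatureDominates ht hItot h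
  have hess : ∀ z ∈ S.Y q, CognitiveRadio.power z ≠ 0 → ∀ lam : ℝ, 0 ≤ lam → lam ≤ S.lamMax →
      CognitiveRadio.HasPosDefHessianAt (S.lagrangian q x price lam) z := by
    intro z hz hp lam hlam0 hlam
    refine CognitiveRadio.System.hasPosDefHessianAt_lagrangian hW0 hW (add_nonneg hlam0 hprice0)
      (hWK _ ?_) hz hx hp
    linarith [le_max_left t S.lamMax, le_max_right t S.lamMax]
  obtain ⟨z, hz⟩ := hfeas
  exact ⟨hess, CognitiveRadio.System.existsUnique_bestResponse ⟨z, hz.1⟩ hx hprice0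
    fun lam hlam => CognitiveRadio.strictConvexOn_of_hasPosDefHessianAt
      CognitiveRadio.System.convex_Y_power_ne_zero fun y hy =>
        hess y hy.1 hy.2 lam hlam.1
          (hlam.2.trans CognitiveRadio.System.one_div_ILoc_le_lamMax)⟩
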